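/- **Setting.** Let $T>0$, $a\in[0,1]$, $I=[r_{\min},r_{\max}]\subset(0,\infty)$ a compact interval and $V(r)=\tfrac43\pi r^3$. Let $\tau:I\to\mathbb R$ be nowhere zero with $\tau$ and $\tau^{-1}=1/\tau$ bounded and Lipschitz, let $\sigma:I\to\mathbb R$ and $\mu_{Li}:\mathbb R\to\mathbb R$ be bounded and Lipschitz, and let $q\in C^1([0,T])$ with derivative $\dot q$. Write $C_T=C([0,T],\mathbb R)$ and $C_T([0,1])=C([0,T],[0,1])$ with the supremum norm, $L^N(x^1,\dots,x^N)=\frac1N\sum_{i=1}^N\delta_{x^i}$ for the empirical measure, and let $n(0)=-1$, $n(1)=1$ be the outer normal of $(0,1)$. *Particle system.* Given $r^1,r^2,\dots\in I$ and independent standard real Brownian motions $W^1,W^2,\dots$ on $[0,T]$, started at $0$ and with continuous paths, on a probability space $(\Omega,\mathcal A,\mathbb P)$, a solution of the $N$-particle system is a family of random variables $(Y^{i,N},k^{i,N})_{i\le N}$ with values in $C_T([0,1])\times C_T$ such that, $\mathbb P$-a.s., for all $i\le N$ and $t\in[0,T]$, $Y^{i,N}_0=a$, $k^{i,N}_0=0$,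 $k^{i,N}$ has bounded variation, and $$Y^{i,N}_t=a+\int_0^t\frac{1}{\tau(r^i)}\bigl(\Lambda^N_s-\mu_{Li}(Y^{i,N}_s)\bigr)\,ds+\sigma(r^i)W^i_t-k^{i,N}_t,\qquad d|k^{i,N}|_t=1_{\{Y^{i,N}_t\in\{0,1\}\}}\,d|k^{i,N}|_t,\quad dk^{i,N}_t=n(Y^{i,N}_t)\,d|k^{i,N}|_t,$$ $$\Lambda^N_s=\frac{\sum_{j=1}^N\bigl[V(r^j)\dot q_s+\mu_{Li}(Y^{j,N}_s)V(r^j)/\tau(r^j)\bigr]}{\sum_{j=1}^N V(r^j)/\tau(r^j)} .$$ Here $d|k|$ is the total variation measure of $dk$. *Limit equation.* For a probability measure $\nu$ on $[0,1]\times I$ put $$\Lambda_t(\nu)=\frac{\int [V(r)\dot q_t+\mu_{Li}(x)V(r)/\tau(r)]\,\nu(d(x,r))}{\int V(r)/\tau(r)\,\nu(d(x,r))},\qquad b(t,x,r,\nu)=\frac1{\tau(r)}\bigl(\Lambda_t(\nu)-\mu_{Li}(x)\bigr).$$ On a probability space carrying a $C_T$-valued random variable $W$ and an $I$-valued random variable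 $R$, a solution of the reflected McKean–Vlasov equation with inputs $(W,R)$ is a random variable $(X,k)$ with values in $C_T([0,1])\times C_T$ such that, almost surely, for all $t\in[0,T]$, $X_0=a$, $k_0=0$, $k$ has bounded variation, and $$X_t=a+\int_0^t b\bigl(s,X_s,R,\mathcal L(X_s,R)\bigr)ds+\sigma(R)W_t-k_t,\qquad d|k|_t=1_{\{X_t\in\{0,1\}\}}\,d|k|_t,\quad dk_t=n(X_t)\,d|k|_t .$$ **Proposition.** Let $(W^i)_{i\ge1}$ be independent Brownian motions as above and let $(r^i)_{i\ge1}$ be a deterministic sequence in $I$ such that $L^N(r^1,\dots,r^N)$ converges weakly to a probability measure $\lambda$ on $I$. Then: 1. For every $N$, the $N$-particle system has a solution $(Y^{i,N},k^{i,N})_{i\le N}$, and any two solutions are $\mathbb P$-a.s. equal. 2. There is a probability measure $\rho$ on $C_T([0,1])\times C_T$ such that, on every probability space carrying inputs $(W,R)$ with law $\mu_{\mathcal W}\otimes\lambda$ ($\mu_{\mathcal W}$ the Wiener measure on $C_T$), the reflected McKean–Vlasov equation has a solution $(X,k)$, any two solutions are a.s. equal, $\mathbb E|k_t|^p<\infty$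 for all $t\in[0,T]$ and $p\in[1,\infty)$, and $\mathcal L(X,k)=\rho$. 3. $\mathbb P$-almost surely, the empirical measures $L^N\bigl((Y^{i,N},k^{i,N})_{i\le N}\bigr)$ of the solutions of the particle systems converge weakly to $\rho=\mathcal L(X,k)$ as $N\to\infty$. -/

import Mathlib

open MeasureTheory ProbabilityTheory Filter Topology
open scoped NNReal ENNReal

noncomputable section

namespace Battery

/-- The space `C_T(E)` of continuous paths `[0,T] → E`, with the topology of uniform convergence. -/
abbrev PathSpace (T : ℝ) (E : Type) [TopologicalSpace E] : Type := C(Set.Icc (0 : ℝ) T, E)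

/-- Path spaces carry their Borel `σ`-algebra. -/
instance instMeasurableSpacePathSpace (T : ℝ) (E : Type) [TopologicalSpace E] :
    MeasurableSpace (PathSpace T E) := borel _

instance instBorelSpacePathSpace (T : ℝ) (E : Type) [TopologicalSpace E] :
    BorelSpace (PathSpace T E) := ⟨rfl⟩

/-- The space `C_T([0,1]) × C_T` in which the pair (mole fraction, reflection term) lives. -/
abbrev StatePath (T : ℝ) : Type := PathSpace T unitInterval × PathSpace T ℝ

/-- The empirical measure `L^n(x) = (1/n) ∑ i, δ_{x i}` of `n ≥ 1` points. -/
def empiricalMeasure {E : Type*} [MeasurableSpace E] {n : ℕ} [NeZero n] (x : Fin n → E) :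
    ProbabilityMeasure E :=
  ⟨(n : ℝ≥0∞)⁻¹ • ∑ i, Measure.dirac (x i), ⟨by
    simp [ENNReal.inv_mul_cancel, NeZero.ne n]⟩⟩

/-- Intervals of the compact interval `[0,T]` are compact. -/
instance instCompactIccSpaceTime (T : ℝ) : CompactIccSpace (Set.Icc (0 : ℝ) T) :=
  ⟨fun {_ _} ↦ isClosed_Icc.isCompact⟩

/-- Lebesgue measure on the time interval `[0,T]`. -/
def timeMeasure (T : ℝ) : Measure (Set.Icc (0 : ℝ) T) :=
  (volume : Measure ℝ).comap Subtype.val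

/-- `W` is a Brownian motion on the time interval `[0,T]` with continuous paths: a random variable
with values in `C_T` whose law is the Wiener measure, that is, whose finite-dimensional laws are
those of the standard real Brownian motion (started at `0`). -/
structure IsBrownianPath {T : ℝ} {Ω : Type*} [MeasurableSpace Ω]
    (W : Ω → PathSpace T ℝ) (P : Measure Ω) : Prop where
  measurable : Measurable W
  hasLaw : ∀ (J : Finset ℝ≥0) (hJ : ∀ t ∈ J, (t : ℝ) ≤ T),
    HasLaw (fun ω (t : J) ↦ W ω ⟨(t.1 : ℝ), t.1.2, hJ t.1 t.2⟩)
      (BrownianReal.projectiveFamily J) P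

/-- The data of the battery model on `[0,T]`, with the standing assumptions on them. -/
structure Model (T : ℝ) where
  /-- smallest radius -/
  rmin : ℝ
  /-- largest radius -/
  rmax : ℝ
  rmin_pos : 0 < rmin
  /-- common initial mole fraction -/
  a : ℝ
  a_mem : a ∈ Set.Icc (0 : ℝ) 1
  /-- relaxation time, as a function of the radius -/
  τ : Set.Icc rmin rmax → ℝ
  τ_ne_zero : ∀ r, τ r ≠ 0
  τ_lipschitz : ∃ K, LipschitzWith K τ
  τ_bounded : ∃ C, ∀ r, |τ r| ≤ C
  τ_inv_lipschitz : ∃ K, LipschitzWith K fun r ↦ (τ r)⁻¹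
  τ_inv_bounded : ∃ C, ∀ r, |(τ r)⁻¹| ≤ C
  /-- noise intensity, as a function of the radius -/
  σ : Set.Icc rmin rmax → ℝ
  σ_lipschitz : ∃ K, LipschitzWith K σ
  σ_bounded : ∃ C, ∀ r, |σ r| ≤ C
  /-- chemical potential of lithium -/
  μLi : ℝ → ℝ
  μLi_lipschitz : ∃ K, LipschitzWith K μLi
  μLi_bounded : ∃ C, ∀ x, |μLi x| ≤ C
  /-- state of charge -/
  q : ℝ → ℝ
  q_contDiff : ContDiffOn ℝ 1 q (Set.Icc 0 T)

/-- The outer unit normal of `(0,1)` at its boundary points: `n(0) = -1` and `n(1) = 1`. -/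
def outerNormal (x : ℝ) : ℝ := if x = 0 then -1 else if x = 1 then 1 else 0

/-- The signed measure `dk` on `[0,T]` of a function `k` of bounded variation. For continuous `k`,
it gives mass `k t - k s` to the interval `(s,t]`, and no mass to `{0}`. -/
def stieltjes {T : ℝ} {k : Set.Icc (0 : ℝ) T → ℝ} (hk : BoundedVariationOn k Set.univ) :
    SignedMeasure (Set.Icc (0 : ℝ) T) := hk.vectorMeasure

/-- For continuous `k`, the measure `dk` is determined by the increments of `k`. -/
theorem stieltjes_Ioc {T : ℝ} (k : PathSpace T ℝ) (hk : BoundedVariationOn (fun t ↦ k t) Set.univ)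
    {s t : Set.Icc (0 : ℝ) T} (hst : s ≤ t) : stieltjes hk (Set.Ioc s t) = k t - k s := by
  have h : ∀ u, Function.rightLim (fun t ↦ k t) u = k u := fun u ↦
    ContinuousWithinAt.rightLim_eq k.continuous.continuousWithinAt
  rw [stieltjes, hk.vectorMeasure_Ioc hst, h, h]

/-- The deterministic Skorokhod problem on `[0,1]`: `(x,k)` solves
`dx = v dt + dz - dk`, `x_0 = a`, with `k` continuous of bounded variation, `k_0 = 0`,
`d|k| = 1_{x ∈ {0,1}} d|k|` and `dk = n(x) d|k|`. Here `dk` is the signed (Stieltjes) measure on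
`[0,T]` of the function `k` and `d|k|` is its total variation. The paths `z` start at `0`. -/
structure IsSkorokhodSolution {T : ℝ} (a : ℝ) (v : Set.Icc (0 : ℝ) T → ℝ) (z : PathSpace T ℝ)
    (x : PathSpace T unitInterval) (k : PathSpace T ℝ) : Prop where
  x_init : ∀ t : Set.Icc (0 : ℝ) T, (t : ℝ) = 0 → (x t : ℝ) = a
  k_init : ∀ t : Set.Icc (0 : ℝ) T, (t : ℝ) = 0 → k t = 0
  eqn : ∀ t, (x t : ℝ) = a + (∫ s in Set.Iic t, v s ∂timeMeasure T) + z t - k t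
  bv : BoundedVariationOn (fun t ↦ k t) Set.univ
  boundary : (stieltjes bv).totalVariation =
    (stieltjes bv).totalVariation.restrict {t | (x t : ℝ) = 0 ∨ (x t : ℝ) = 1}
  normal : stieltjes bv =
    (stieltjes bv).totalVariation.withDensityᵥ fun t ↦ outerNormal (x t)

namespace Model

variable {T : ℝ} (M : Model T)

/-- The range `I = [r_min, r_max]` of admissible radii. -/
abbrev Radius : Type := Set.Icc M.rmin M.rmax

/-- The volume `V(r) = 4πr³/3` of a particle of radius `r`. -/
def vol (r : M.Radius) : ℝ := 4 * Real.pi * (r : ℝ) ^ 3 / 3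

/-- The derivative of the state of charge (one-sided at the end points of `[0,T]`). -/
def qdot (t : ℝ) : ℝ := derivWithin M.q (Set.Icc 0 T) t

/-- The surface chemical potential of `N` particles with radii `r j` and mole fractions `y j`. -/
def particlePotential {N : ℕ} (t : ℝ) (r : Fin N → M.Radius) (y : Fin N → ℝ) : ℝ :=
  (∑ j, (M.vol (r j) * M.qdot t + M.μLi (y j) * (M.vol (r j) / M.τ (r j)))) /
    ∑ j, M.vol (r j) / M.τ (r j)

/-- The surface chemical potential when mole fraction and radius have joint law `ν`. -/
def potential (t : ℝ) (ν : Measure (unitInterval × M.Radius)) : ℝ :=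
  (∫ p, (M.vol p.2 * M.qdot t + M.μLi p.1 * (M.vol p.2 / M.τ p.2)) ∂ν) /
    ∫ p, M.vol p.2 / M.τ p.2 ∂ν

/-- The drift `b(t,x,r,ν) = (Λ_t(ν) - μ_Li(x)) / τ(r)`. -/
def drift (t x : ℝ) (r : M.Radius) (ν : Measure (unitInterval × M.Radius)) : ℝ :=
  (1 / M.τ r) * (M.potential t ν - M.μLi x)

/-- `Z = (Y^i, k^i)_{i < N}` is a solution of the `N`-particle system with deterministic radii `r`
and driving noises `W`. -/
structure IsParticleSolution {Ω : Type*} [MeasurableSpace Ω] (P : Measure Ω) {N : ℕ}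
    (r : Fin N → M.Radius) (W : Fin N → Ω → PathSpace T ℝ)
    (Z : Ω → Fin N → StatePath T) : Prop where
  measurable : Measurable Z
  solves : ∀ᵐ ω ∂P, ∀ i, IsSkorokhodSolution M.a
    (fun s ↦ (1 / M.τ (r i)) *
      (M.particlePotential s r (fun j ↦ ((Z ω j).1 s : ℝ)) - M.μLi ((Z ω i).1 s)))
    (M.σ (r i) • W i ω) (Z ω i).1 (Z ω i).2

/-- `Z = (X,k)` is a solution of the reflected McKean-Vlasov equation
`dX = b(t,X,R,Law(X_t,R)) dt + σ(R) dW - dk`, `X_0 = a`, with inputs `W` and `R`. -/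
structure IsMcKeanVlasovSolution {Ω : Type*} [MeasurableSpace Ω] (P : Measure Ω)
    (W : Ω → PathSpace T ℝ) (R : Ω → M.Radius) (Z : Ω → StatePath T) : Prop where
  measurable : Measurable Z
  solves : ∀ᵐ ω ∂P, IsSkorokhodSolution M.a
    (fun s ↦ M.drift s ((Z ω).1 s) (R ω) (P.map fun ω' ↦ ((Z ω').1 s, R ω')))
    (M.σ (R ω) • W ω) (Z ω).1 (Z ω).2

end Model

end Battery

end

noncomputable section

namespace Battery

/-! ### Reflected paths -/

/-! The noise is additive, so everything can be done path by path. For a given continuous surface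
potential `Λ`, a particle with radius `r` and noise `w` follows a deterministic path `response Λ (r,
w)`. For a law `m` of pairs (radius, noise), the particles responding to `Λ` generate the potential
`meanPotential m Λ`. This map is of Volterra type in `Λ`, with constants independent of `m`, so it
has a unique fixed point `selfPotential m`. The particle system is this fixed-point problem with `m`
the empirical measure of the pairs `(r i, W i)`, and the McKean–Vlasov equation is the same problem
with `m = λ ⊗ Wiener` (`particleSystem_iff`, `isMcKeanVlasovSolution_iff`). Existence and uniqueness
follow for both.

Convergence is then continuity in `m`. The empirical measure of the solutions is the image of the
empirical measure of the inputs under `selfResponse` of the latter. The inputs converge weakly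
almost surely, by Hoeffding's inequality and Borel–Cantelli (`ae_tendsto_empiricalMeasure_prod`),
and the maps converge uniformly (`tendsto_selfResponse`). Hence the images converge
(`tendsto_of_tendstoUniformly`).

The reflection enters through the order form `IsReflected`, from which a comparison argument makes
the regulator 1-Lipschitz in the input (`regulator_sub_le`). Solutions are built by one-sided
reflections on short time intervals, and their monotone parts give the Jordan decomposition of `dk`.
-/

/-- The order-theoretic form of the Skorokhod problem on `[0,1]`: `x = y - k`, where `k` decreases
while `x` stays away from `1` and increases while `x` stays away from `0`. -/
structure IsReflected {T : ℝ} (y : PathSpace T ℝ) (x : PathSpace T unitInterval)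
    (k : PathSpace T ℝ) : Prop where
  init : ∀ t : Set.Icc (0 : ℝ) T, (t : ℝ) = 0 → k t = 0
  eqn : ∀ t, (x t : ℝ) = y t - k t
  anti : ∀ s t, s ≤ t → (∀ u ∈ Set.Icc s t, (x u : ℝ) < 1) → k t ≤ k s
  mono : ∀ s t, s ≤ t → (∀ u ∈ Set.Icc s t, 0 < (x u : ℝ)) → k s ≤ k t

/-- A continuous function that ends above the level `c` stays above it after its last passage. -/
theorem exists_last_passage {f : ℝ → ℝ} (hf : Continuous f) {a t c : ℝ} (hat : a ≤ t)
    (ha : f a ≤ c) (ht : c < f t) : ∃ s ∈ Set.Icc a t, f s = c ∧ ∀ u ∈ Set.Icc s t, c ≤ f u := by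
  have hK : IsCompact (Set.Icc a t ∩ {u | f u ≤ c}) :=
    isCompact_Icc.inter_right (isClosed_le hf continuous_const)
  obtain ⟨s, ⟨hs, hsc⟩, hmax⟩ := hK.exists_isGreatest ⟨a, ⟨le_rfl, hat⟩, ha⟩
  have hgt : ∀ u ∈ Set.Ioc s t, c < f u := fun u hu ↦ by
    by_contra! h
    exact (hmax ⟨⟨hs.1.trans hu.1.le, hu.2⟩, h⟩).not_gt hu.1
  have hfs : f s = c := by
    refine le_antisymm hsc ?_
    by_contra! h
    obtain ⟨u, hu, huc⟩ := intermediate_value_Icc hs.2 hf.continuousOn ⟨h.le, ht.le⟩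
    rcases hu.1.eq_or_lt with rfl | h'
    · exact h.ne huc
    · exact (hgt u ⟨h', hu.2⟩).ne' huc
  refine ⟨s, hs, hfs, fun u hu ↦ ?_⟩
  rcases hu.1.eq_or_lt with rfl | h'
  · exact hfs.ge
  · exact (hgt u ⟨h', hu.2⟩).le

namespace IsReflected

variable {T : ℝ} {y y' : PathSpace T ℝ} {x x' : PathSpace T unitInterval} {k k' : PathSpace T ℝ}

/-- If `k - k'` exceeded `e` at time `t`, take a level `c` strictly between. After the last passage
of `c`, `k - k' ≥ c > e ≥ y - y'`, so `x < x'`. Thus `x` is off 1 and `x'` is off 0, `k` cannot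
increase and `k'` cannot decrease, and `k - k'` never gets above `c` again. -/
theorem regulator_sub_le (h : IsReflected y x k) (h' : IsReflected y' x' k')
    {t : Set.Icc (0 : ℝ) T} {e : ℝ} (he : ∀ s ≤ t, |y s - y' s| ≤ e) : k t - k' t ≤ e := by
  by_contra! hlt
  have hT : 0 ≤ T := t.2.1.trans t.2.2
  have he0 : 0 ≤ e := (abs_nonneg _).trans (he t le_rfl)
  obtain ⟨c, hec, hct⟩ := exists_between hlt
  let g : ℝ → ℝ := Set.IccExtend hT fun u ↦ k u - k' u
  have hg : Continuous g := Continuous.Icc_extend' (k.continuous.sub k'.continuous)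
  have hgu : ∀ u : Set.Icc (0 : ℝ) T, g u = k u - k' u := fun u ↦ Set.IccExtend_val hT _ u
  have hg0 : g 0 ≤ c := by
    have := hgu ⟨0, le_rfl, hT⟩
    rw [h.init _ rfl, h'.init _ rfl, sub_zero] at this
    exact (this.trans_lt (he0.trans_lt hec)).le
  obtain ⟨s, hs, hsc, habove⟩ := exists_last_passage hg t.2.1 hg0 (by rw [hgu]; exact hct)
  let s' : Set.Icc (0 : ℝ) T := ⟨s, hs.1, hs.2.trans t.2.2⟩
  have hst : s' ≤ t := hs.2
  have hlt' : ∀ u ∈ Set.Icc s' t, (x u : ℝ) < x' u := fun u hu ↦ by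
    have h1 := habove u ⟨hu.1, hu.2⟩
    rw [hgu] at h1
    have h2 := le_of_abs_le (he u hu.2)
    rw [h.eqn, h'.eqn]
    linarith
  have h1 := h.anti s' t hst fun u hu ↦ (hlt' u hu).trans_le (x' u).2.2
  have h2 := h'.mono s' t hst fun u hu ↦ (x u).2.1.trans_lt (hlt' u hu)
  have h3 := hgu s'
  rw [show g s' = c from hsc] at h3
  linarith

/-- The regulator of a reflected path is a `1`-Lipschitz function of the path. -/
theorem abs_regulator_sub_le (h : IsReflected y x k) (h' : IsReflected y' x' k')
    {t : Set.Icc (0 : ℝ) T} {e : ℝ} (he : ∀ s ≤ t, |y s - y' s| ≤ e) : |k t - k' t| ≤ e :=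
  abs_sub_le_iff.2 ⟨h.regulator_sub_le h' he,
    h'.regulator_sub_le h fun s hs ↦ by rw [abs_sub_comm]; exact he s hs⟩

/-- The reflected path is a `2`-Lipschitz function of the original one. -/
theorem abs_sub_le (h : IsReflected y x k) (h' : IsReflected y' x' k')
    {t : Set.Icc (0 : ℝ) T} {e : ℝ} (he : ∀ s ≤ t, |y s - y' s| ≤ e) :
    |(x t : ℝ) - x' t| ≤ 2 * e := by
  have h1 := abs_regulator_sub_le h h' he
  have h2 := he t le_rfl
  rw [h.eqn, h'.eqn]
  rw [abs_le] at *
  constructor <;> linarith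

theorem unique (h : IsReflected y x k) (h' : IsReflected y x' k') : x = x' ∧ k = k' := by
  constructor
  · ext t
    have := h.abs_sub_le h' (t := t) (e := 0) (by simp)
    rw [mul_zero, abs_nonpos_iff, sub_eq_zero] at this
    exact this
  · ext t
    have := h.abs_regulator_sub_le h' (t := t) (e := 0) (by simp)
    rwa [abs_nonpos_iff, sub_eq_zero] at this

end IsReflected

/-- The deterministic Skorokhod problem implies its order-theoretic form. -/
theorem IsSkorokhodSolution.isReflected {T : ℝ} {a : ℝ} {v : Set.Icc (0 : ℝ) T → ℝ}
    {z : PathSpace T ℝ} {x : PathSpace T unitInterval} {k y : PathSpace T ℝ}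
    (h : IsSkorokhodSolution a v z x k)
    (hy : ∀ t, y t = a + (∫ s in Set.Iic t, v s ∂timeMeasure T) + z t) : IsReflected y x k := by
  have key : ∀ s t, s ≤ t → k t - k s =
      (stieltjes h.bv).totalVariation.withDensityᵥ (fun t ↦ outerNormal (x t)) (Set.Ioc s t) :=
    fun s t hst ↦ by rw [← h.normal, stieltjes_Ioc k h.bv hst]
  refine ⟨h.k_init, fun t ↦ by rw [h.eqn, hy], fun s t hst hx ↦ ?_, fun s t hst hx ↦ ?_⟩
  · rw [← sub_nonpos, key s t hst]
    -- For a non-integrable density `withDensityᵥ` is zero by convention, so the increment vanishes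
    -- and the inequality is trivial.
    by_cases hi : Integrable (fun t ↦ outerNormal (x t)) (stieltjes h.bv).totalVariation
    · rw [withDensityᵥ_apply hi measurableSet_Ioc]
      refine setIntegral_nonpos measurableSet_Ioc fun u hu ↦ ?_
      have := hx u ⟨hu.1.le, hu.2⟩
      unfold outerNormal
      split_ifs <;> linarith
    · simp [Measure.withDensityᵥ, hi]
  · rw [← sub_nonneg, key s t hst]
    by_cases hi : Integrable (fun t ↦ outerNormal (x t)) (stieltjes h.bv).totalVariation
    · rw [withDensityᵥ_apply hi measurableSet_Ioc]
      refine setIntegral_nonneg measurableSet_Ioc fun u hu ↦ ?_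
      have := hx u ⟨hu.1.le, hu.2⟩
      unfold outerNormal
      split_ifs <;> linarith
    · simp [Measure.withDensityᵥ, hi]

/-! ### Construction of reflected paths -/

/-- One-sided reflection at `0` of a function that oscillates little. -/
theorem exists_lower_regulator {w : ℝ → ℝ} (hw : Continuous w) {S h : ℝ} (hh : 0 ≤ h)
    (hS : w S ∈ Set.Icc (0 : ℝ) (1 / 2)) (hosc : ∀ t ∈ Set.Icc S (S + h), |w t - w S| ≤ 1 / 4) :
    ∃ g : ℝ → ℝ, Continuous g ∧ Monotone g ∧ g S = 0 ∧
      (∀ t ∈ Set.Icc S (S + h), w t + g t ∈ Set.Icc (0 : ℝ) 1) ∧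
      ∀ s t, S ≤ s → s ≤ t → t ≤ S + h → (∀ u ∈ Set.Icc s t, 0 < w u + g u) → g t = g s := by
  -- The regulator is the running maximum of the negative part of `w`. Clamping `u` to `[S, t]` lets
  -- the supremum run over a fixed compact set, so that joint continuity of `f` gives continuity of
  -- `g`.
  let f : ℝ → ℝ → ℝ := fun t u ↦ max 0 (-w (max S (min u t)))
  have hf : Continuous (fun p : ℝ × ℝ ↦ f p.1 p.2) := by fun_prop
  have hft : ∀ t, Continuous (f t) := fun t ↦ by fun_prop
  let K := Set.Icc S (S + h)
  have hK : IsCompact K := isCompact_Icc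
  have hKne : K.Nonempty := ⟨S, le_rfl, by linarith⟩
  let g : ℝ → ℝ := fun t ↦ sSup (f t '' K)
  have hbdd : ∀ t, BddAbove (f t '' K) := fun t ↦ (hK.image (hft t)).bddAbove
  have hle : ∀ t, ∀ u ∈ K, f t u ≤ g t := fun t u hu ↦ le_csSup (hbdd t) ⟨u, hu, rfl⟩
  have hatt : ∀ t, ∃ u ∈ K, g t = f t u := fun t ↦ hK.exists_sSup_image_eq hKne (hft t).continuousOn
  have hg0 : ∀ t, 0 ≤ g t := fun t ↦ (le_max_left _ _).trans (hle t S ⟨le_rfl, by linarith⟩)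
  have hmono : Monotone g := fun t t' htt' ↦ by
    obtain ⟨u, hu, hgu⟩ := hatt t
    rw [hgu]
    have : f t u = f t' (max S (min u t)) := by
      simp only [f]
      congr 3
      rcases le_total S (min u t) with h1 | h1
      · rw [max_eq_right h1, min_eq_left ((min_le_right _ _).trans htt'), max_eq_right h1]
      · rw [max_eq_left h1]
        rw [max_eq_left (min_le_left _ _)]
    rw [this]
    exact hle t' _ ⟨le_max_left _ _, max_le (by linarith) ((min_le_left _ _).trans hu.2)⟩
  have hlow : ∀ t ∈ K, -w t ≤ g t := fun t ht ↦ by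
    have h1 := hle t t ht
    have h2 : f t t = max 0 (-w t) := by simp only [f, min_self, max_eq_right ht.1]
    exact (le_max_right _ _).trans (h2 ▸ h1)
  have hcases : ∀ t, ∃ v ∈ K, v ≤ max S t ∧ g t = max 0 (-w v) := fun t ↦ by
    obtain ⟨u, hu, hgu⟩ := hatt t
    exact ⟨max S (min u t), ⟨le_max_left _ _, max_le (by linarith) ((min_le_left _ _).trans hu.2)⟩,
      max_le_max le_rfl (min_le_right _ _), hgu⟩
  refine ⟨g, hK.continuous_sSup hf, hmono, ?_, fun t ht ↦ ⟨by linarith [hlow t ht], ?_⟩, ?_⟩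
  · obtain ⟨v, hv, hvS, hgv⟩ := hcases S
    rw [max_self] at hvS
    rw [hgv, le_antisymm hvS hv.1, max_eq_left (by linarith [hS.1])]
  · obtain ⟨v, hv, -, hgv⟩ := hcases t
    have h1 := abs_le.1 (hosc t ht)
    have h2 := abs_le.1 (hosc v hv)
    -- Here `w ≥ -1/4` and `w ≤ 1/2 + 1/4`, so adding at most 1/4 never pushes the path above 1.
    have : g t ≤ 1 / 4 := by rw [hgv]; exact max_le (by norm_num) (by linarith [hS.1])
    linarith [hS.2]
  · intro s t hSs hst hth hpos
    refine le_antisymm ?_ (hmono hst)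
    obtain ⟨v, hv, hvt, hgv⟩ := hcases t
    rw [max_eq_right (hSs.trans hst)] at hvt
    rcases le_total (-w v) 0 with h1 | h1
    · rw [hgv, max_eq_left h1]; exact hg0 s
    · rw [max_eq_right h1] at hgv
      -- The maximum at time `t` is attained at `v`. If `v` came after `s`, then `w v + g v ≤ w v +
      -- g t = 0`, against positivity on `[s, t]`.
      rcases le_or_gt v s with h2 | h2
      · rw [hgv]; exact (hlow v hv).trans (hmono h2)
      · have h3 := hpos v ⟨h2.le, hvt⟩
        linarith [hmono hvt]

/-- The properties of a decomposition `p - n` of the regulator on `[0,S]` into its parts at the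
boundary points `1` and `0`. -/
structure IsRegulatorOn (y : ℝ → ℝ) (S : ℝ) (p n : ℝ → ℝ) : Prop where
  cont_p : Continuous p
  cont_n : Continuous n
  mono_p : Monotone p
  mono_n : Monotone n
  init_p : p 0 = 0
  init_n : n 0 = 0
  mem : ∀ t ∈ Set.Icc 0 S, y t - p t + n t ∈ Set.Icc (0 : ℝ) 1
  const_p : ∀ s t, 0 ≤ s → s ≤ t → t ≤ S → (∀ u ∈ Set.Icc s t, y u - p u + n u < 1) → p t = p s
  const_n : ∀ s t, 0 ≤ s → s ≤ t → t ≤ S → (∀ u ∈ Set.Icc s t, 0 < y u - p u + n u) → n t = n s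

/-- With oscillation at most 1/4, a path starting in the lower half never needs the barrier at 1. In
the upper half the mirrored path `1 - w` is reflected at 0 instead. So one of `p`, `n` is zero. -/
theorem exists_regulator_step {w : ℝ → ℝ} (hw : Continuous w) {S h : ℝ} (hh : 0 ≤ h)
    (hS : w S ∈ Set.Icc (0 : ℝ) 1) (hosc : ∀ t ∈ Set.Icc S (S + h), |w t - w S| ≤ 1 / 4) :
    ∃ p n : ℝ → ℝ, Continuous p ∧ Continuous n ∧ Monotone p ∧ Monotone n ∧ p S = 0 ∧ n S = 0 ∧
      (∀ t ∈ Set.Icc S (S + h), w t - p t + n t ∈ Set.Icc (0 : ℝ) 1) ∧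
      (∀ s t, S ≤ s → s ≤ t → t ≤ S + h → (∀ u ∈ Set.Icc s t, w u - p u + n u < 1) → p t = p s) ∧
      ∀ s t, S ≤ s → s ≤ t → t ≤ S + h → (∀ u ∈ Set.Icc s t, 0 < w u - p u + n u) → n t = n s := by
  rcases le_total (w S) (1 / 2) with h2 | h2
  · obtain ⟨g, hg, hm, hgS, hmem, hc⟩ := exists_lower_regulator hw hh ⟨hS.1, h2⟩ hosc
    refine ⟨0, g, continuous_const, hg, monotone_const, hm, rfl, hgS, ?_, fun _ _ _ _ _ _ ↦ rfl, ?_⟩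
    · simpa using hmem
    · simpa using hc
  · obtain ⟨g, hg, hm, hgS, hmem, hc⟩ := exists_lower_regulator (w := fun t ↦ 1 - w t)
      (by fun_prop) hh ⟨by linarith [hS.2], by linarith⟩
      (fun t ht ↦ by rw [abs_sub_comm, sub_sub_sub_cancel_left]; exact hosc t ht)
    refine ⟨g, 0, hg, continuous_const, hm, monotone_const, hgS, rfl, fun t ht ↦ ?_,
      fun s t h1 h3 h4 h5 ↦ hc s t h1 h3 h4 fun u hu ↦ ?_, fun _ _ _ _ _ _ ↦ rfl⟩
    · have := hmem t ht
      simp only [Pi.zero_apply, Set.mem_Icc] at *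
      constructor <;> linarith
    · have := h5 u hu
      simp only [Pi.zero_apply] at this
      linarith

/-- The step is applied to `y` shifted by the regulators frozen at time `S`. The new parts vanish at
`S`, so they glue to the old ones through `min t S` and `max t S`; constancy across `S` is checked
by splitting there. -/
theorem IsRegulatorOn.extend {y : ℝ → ℝ} (hy : Continuous y) {S h : ℝ} (hS : 0 ≤ S) (hh : 0 ≤ h)
    (hosc : ∀ t ∈ Set.Icc S (S + h), |y t - y S| ≤ 1 / 4) {p n : ℝ → ℝ}
    (H : IsRegulatorOn y S p n) : ∃ p' n', IsRegulatorOn y (S + h) p' n' := by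
  obtain ⟨p₁, n₁, cp, cn, mp, mn, ip, in', mem, constp, constn⟩ :=
    exists_regulator_step (w := fun t ↦ y t - p S + n S) (by fun_prop) hh (H.mem S ⟨hS, le_rfl⟩)
      (fun t ht ↦ by
        have : y t - p S + n S - (y S - p S + n S) = y t - y S := by ring
        rw [this]; exact hosc t ht)
  have hp1 : ∀ t ≤ S, p (min t S) + p₁ (max t S) = p t := fun t ht ↦ by
    rw [min_eq_left ht, max_eq_right ht, ip, add_zero]
  have hn1 : ∀ t ≤ S, n (min t S) + n₁ (max t S) = n t := fun t ht ↦ by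
    rw [min_eq_left ht, max_eq_right ht, in', add_zero]
  have hp2 : ∀ t, S ≤ t → p (min t S) + p₁ (max t S) = p S + p₁ t := fun t ht ↦ by
    rw [min_eq_right ht, max_eq_left ht]
  have hn2 : ∀ t, S ≤ t → n (min t S) + n₁ (max t S) = n S + n₁ t := fun t ht ↦ by
    rw [min_eq_right ht, max_eq_left ht]
  have const_of : ∀ {f : ℝ → ℝ} {P : ℝ → Prop},
      (∀ s t, 0 ≤ s → s ≤ t → t ≤ S → (∀ u ∈ Set.Icc s t, P u) → f t = f s) →
      (∀ s t, S ≤ s → s ≤ t → t ≤ S + h → (∀ u ∈ Set.Icc s t, P u) → f t = f s) →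
      ∀ s t, 0 ≤ s → s ≤ t → t ≤ S + h → (∀ u ∈ Set.Icc s t, P u) → f t = f s := by
    intro f P h1 h2 s t h0 hst hth hP
    rcases le_total t S with htS | htS
    · exact h1 s t h0 hst htS hP
    rcases le_total s S with hsS | hsS
    · rw [h2 S t le_rfl htS hth fun u hu ↦ hP u ⟨hsS.trans hu.1, hu.2⟩,
        h1 s S h0 hsS le_rfl fun u hu ↦ hP u ⟨hu.1, hu.2.trans htS⟩]
    · exact h2 s t hsS hst hth hP
  have cpcn : Continuous (fun t ↦ p (min t S) + p₁ (max t S)) ∧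
      Continuous (fun t ↦ n (min t S) + n₁ (max t S)) :=
    ⟨(H.cont_p.comp (by fun_prop)).add (cp.comp (by fun_prop)),
      (H.cont_n.comp (by fun_prop)).add (cn.comp (by fun_prop))⟩
  refine ⟨fun t ↦ p (min t S) + p₁ (max t S), fun t ↦ n (min t S) + n₁ (max t S),
    cpcn.1, cpcn.2,
    fun s t hst ↦ add_le_add (H.mono_p (min_le_min_right S hst)) (mp (max_le_max_right S hst)),
    fun s t hst ↦ add_le_add (H.mono_n (min_le_min_right S hst)) (mn (max_le_max_right S hst)),
    (hp1 0 hS).trans H.init_p, (hn1 0 hS).trans H.init_n, fun t ht ↦ ?_, const_of ?_ ?_,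
    const_of ?_ ?_⟩
  · rcases le_total t S with htS | htS
    · simp only [hp1 t htS, hn1 t htS]
      exact H.mem t ⟨ht.1, htS⟩
    · simp only [hp2 t htS, hn2 t htS]
      have := mem t ⟨htS, ht.2⟩
      convert this using 1
      ring
  · intro s t h0 hst htS hu
    simp only [hp1 t htS, hp1 s (hst.trans htS)]
    refine H.const_p s t h0 hst htS fun u hu' ↦ ?_
    have := hu u hu'
    rwa [hp1 u (hu'.2.trans htS), hn1 u (hu'.2.trans htS)] at this
  · intro s t h0 hst htS hu
    simp only [hp2 t (h0.trans hst), hp2 s h0]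
    rw [constp s t h0 hst htS fun u hu' ↦ ?_]
    have := hu u hu'
    rw [hp2 u (h0.trans hu'.1), hn2 u (h0.trans hu'.1)] at this
    linarith
  · intro s t h0 hst htS hu
    simp only [hn1 t htS, hn1 s (hst.trans htS)]
    refine H.const_n s t h0 hst htS fun u hu' ↦ ?_
    have := hu u hu'
    rwa [hp1 u (hu'.2.trans htS), hn1 u (hu'.2.trans htS)] at this
  · intro s t h0 hst htS hu
    simp only [hn2 t (h0.trans hst), hn2 s h0]
    rw [constn s t h0 hst htS fun u hu' ↦ ?_]
    have := hu u hu'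
    rw [hp2 u (h0.trans hu'.1), hn2 u (h0.trans hu'.1)] at this
    linarith

/-- Every uniformly continuous function that starts in `[0,1]` can be reflected. -/
theorem exists_isRegulatorOn {y : ℝ → ℝ} (hy : UniformContinuous y) (h0 : y 0 ∈ Set.Icc (0 : ℝ) 1)
    (T : ℝ) : ∃ p n, IsRegulatorOn y T p n := by
  obtain ⟨δ, hδ, hδ'⟩ := Metric.uniformContinuous_iff.1 hy (1 / 4) (by norm_num)
  have step : ∀ m : ℕ, ∃ p n, IsRegulatorOn y (m * (δ / 2)) p n := by
    intro m
    induction m with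
    | zero =>
      refine ⟨0, 0, continuous_const, continuous_const, monotone_const, monotone_const, rfl, rfl,
        fun t ht ↦ ?_, fun _ _ _ _ _ _ ↦ rfl, fun _ _ _ _ _ _ ↦ rfl⟩
      have : t = 0 := le_antisymm (by simpa using ht.2) ht.1
      simpa [this] using h0
    | succ m ih =>
      obtain ⟨p, n, H⟩ := ih
      rw [Nat.cast_add_one, add_one_mul]
      refine H.extend hy.continuous (by positivity) (by positivity) fun t ht ↦ ?_
      refine (hδ' ?_).le
      rw [Real.dist_eq, abs_of_nonneg (by linarith [ht.1])]
      linarith [ht.2]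
  obtain ⟨m, hm⟩ := exists_nat_ge (T / (δ / 2))
  rw [div_le_iff₀ (by positivity)] at hm
  obtain ⟨p, n, H⟩ := step m
  exact ⟨p, n, H.cont_p, H.cont_n, H.mono_p, H.mono_n, H.init_p, H.init_n,
    fun t ht ↦ H.mem t ⟨ht.1, ht.2.trans hm⟩,
    fun s t h1 h2 h3 ↦ H.const_p s t h1 h2 (h3.trans hm),
    fun s t h1 h2 h3 ↦ H.const_n s t h1 h2 (h3.trans hm)⟩


/-! ### Order-theoretic solutions solve the Skorokhod problem -/

/-- A continuous monotone function as a Stieltjes function. -/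
def monotoneStieltjes {T : ℝ} (p : PathSpace T ℝ) (hp : Monotone p) :
    StieltjesFunction (Set.Icc (0 : ℝ) T) where
  toFun := p
  mono' := hp
  right_continuous' _ := p.continuous.continuousWithinAt

instance isFiniteMeasure_monotoneStieltjes {T : ℝ} (p : PathSpace T ℝ) (hp : Monotone p) :
    IsFiniteMeasure (monotoneStieltjes p hp).measure := by
  obtain ⟨C, hC⟩ := (isCompact_range p.continuous).isBounded.exists_norm_le
  exact StieltjesFunction.isFiniteMeasure_of_forall_abs_le _ (C := C) fun t ↦ hC _ ⟨t, rfl⟩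

theorem monotoneStieltjes_Icc {T : ℝ} (p : PathSpace T ℝ) (hp : Monotone p)
    (s t : Set.Icc (0 : ℝ) T) :
    (monotoneStieltjes p hp).measure (Set.Icc s t) = ENNReal.ofReal (p t - p s) := by
  rw [StieltjesFunction.measure_Icc, ContinuousWithinAt.leftLim_eq]
  · rfl
  · exact p.continuous.continuousWithinAt

/-- A monotone function that is constant on the intervals contained in an open set `U` of times
does not charge `U`. -/
theorem monotoneStieltjes_null {T : ℝ} (p : PathSpace T ℝ) (hp : Monotone p)
    {U : Set (Set.Icc (0 : ℝ) T)} (hU : IsOpen U)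
    (hc : ∀ s t, s ≤ t → Set.Icc s t ⊆ U → p t = p s) :
    (monotoneStieltjes p hp).measure U = 0 := by
  refine measure_null_of_locally_null U fun t ht ↦ ?_
  obtain ⟨ε, hε, hball⟩ := Metric.isOpen_iff.1 hU t ht
  have hT : (0 : ℝ) ≤ T := t.2.1.trans t.2.2
  -- The interval of radius `ε / 2` around `t`, truncated to `[0,T]`, is a neighbourhood of `t`
  -- inside `U`.
  let l : Set.Icc (0 : ℝ) T := Set.projIcc 0 T hT (t - ε / 2)
  let r : Set.Icc (0 : ℝ) T := Set.projIcc 0 T hT (t + ε / 2)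
  have hl : (l : ℝ) = max 0 (min T (t - ε / 2)) := rfl
  have hr : (r : ℝ) = max 0 (min T (t + ε / 2)) := rfl
  have hlt : (l : ℝ) ≤ t := by
    rw [hl]; exact max_le t.2.1 ((min_le_right _ _).trans (by linarith))
  have htr : (t : ℝ) ≤ r := by
    rw [hr]; exact le_max_of_le_right (le_min t.2.2 (by linarith))
  have hl' : (t : ℝ) - ε / 2 ≤ l := by
    rw [hl]; exact le_max_of_le_right (le_min (by linarith [t.2.2]) le_rfl)
  have hr' : (r : ℝ) ≤ t + ε / 2 := by
    rw [hr]; exact max_le (by linarith [t.2.1]) (min_le_right _ _)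
  refine ⟨Set.Icc l r, mem_nhdsWithin_of_mem_nhds (Metric.mem_nhds_iff.2 ⟨ε / 2, by positivity, ?_⟩), ?_⟩
  · intro u hu
    rw [Metric.mem_ball, Subtype.dist_eq, Real.dist_eq, abs_lt] at hu
    constructor
    · change (l : ℝ) ≤ u
      rw [hl]; exact max_le u.2.1 ((min_le_right _ _).trans (by linarith))
    · change (u : ℝ) ≤ r
      rw [hr]; exact le_max_of_le_right (le_min u.2.2 (by linarith))
  · rw [monotoneStieltjes_Icc, hc l r (hlt.trans htr), sub_self, ENNReal.ofReal_zero]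
    intro u hu
    refine hball ?_
    have h1 : (l : ℝ) ≤ u := hu.1
    have h2 : (u : ℝ) ≤ r := hu.2
    rw [Metric.mem_ball, Subtype.dist_eq, Real.dist_eq, abs_lt]
    constructor <;> linarith

/-- Each increment of `p - n` is dominated by the increment of the bounded monotone function `p +
n`, term by term in the variation sums. -/
theorem boundedVariationOn_of_eq_sub {α : Type*} [LinearOrder α] [TopologicalSpace α]
    [CompactSpace α] {k p n : C(α, ℝ)} (hp : Monotone p) (hn : Monotone n)
    (hk : ∀ t, k t = p t - n t) : BoundedVariationOn (fun t ↦ k t) Set.univ := by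
  obtain ⟨C, hC⟩ := (isCompact_range (p + n).continuous).isBounded.exists_norm_le
  have hbv : BoundedVariationOn (p + n) Set.univ :=
    MonotoneOn.boundedVariationOn (C := C) (fun s _ t _ hst ↦ add_le_add (hp hst) (hn hst))
      fun t _ ↦ hC _ ⟨t, rfl⟩
  have hle : ∀ s t, s ≤ t → edist (k t) (k s) ≤ edist ((p + n) t) ((p + n) s) := fun s t hst ↦ by
    rw [edist_dist, edist_dist, Real.dist_eq, Real.dist_eq, hk, hk]
    refine ENNReal.ofReal_le_ofReal ?_
    have h1 := hp hst
    have h2 := hn hst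
    refine le_trans ?_ (le_abs_self _)
    simp only [ContinuousMap.add_apply]
    rw [abs_le]
    constructor <;> linarith
  refine ne_top_of_le_ne_top hbv ?_
  refine iSup_mono fun u ↦ Finset.sum_le_sum fun i _ ↦ hle _ _ (u.2.2.1 (Nat.le_succ i))

/-- The signed measure of a difference of continuous monotone functions. -/
theorem stieltjes_eq_sub {T : ℝ} {k p n : PathSpace T ℝ} (hp : Monotone p) (hn : Monotone n)
    (hk : ∀ t, k t = p t - n t) (bv : BoundedVariationOn (fun t ↦ k t) Set.univ) :
    stieltjes bv = (monotoneStieltjes p hp).measure.toSignedMeasure -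
      (monotoneStieltjes n hn).measure.toSignedMeasure := by
  have hlim : ∀ t, Function.leftLim (fun t ↦ k t) t = k t := fun t ↦
    ContinuousWithinAt.leftLim_eq k.continuous.continuousWithinAt
  have hlim' : ∀ t, Function.rightLim (fun t ↦ k t) t = k t := fun t ↦
    ContinuousWithinAt.rightLim_eq k.continuous.continuousWithinAt
  have hIcc : ∀ s t : Set.Icc (0 : ℝ) T, s ≤ t → stieltjes bv (Set.Icc s t) =
      ((monotoneStieltjes p hp).measure.toSignedMeasure -
      (monotoneStieltjes n hn).measure.toSignedMeasure) (Set.Icc s t) := fun s t hst ↦ by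
    rw [stieltjes, bv.vectorMeasure_Icc hst, hlim, hlim', sub_apply,
      Measure.toSignedMeasure_apply_measurable measurableSet_Icc,
      Measure.toSignedMeasure_apply_measurable measurableSet_Icc, measureReal_def, measureReal_def,
      monotoneStieltjes_Icc, monotoneStieltjes_Icc, ENNReal.toReal_ofReal (sub_nonneg.2 (hp hst)),
      ENNReal.toReal_ofReal (sub_nonneg.2 (hn hst)), hk, hk]
    ring
  rcases isEmpty_or_nonempty (Set.Icc (0 : ℝ) T) with hemp | ⟨⟨t₀⟩⟩
  · ext A -
    simp [Set.eq_empty_of_isEmpty A]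
  have hT : (0 : ℝ) ≤ T := t₀.2.1.trans t₀.2.2
  let b : Set.Icc (0 : ℝ) T := ⟨0, le_rfl, hT⟩
  let e : Set.Icc (0 : ℝ) T := ⟨T, hT, le_rfl⟩
  have hIic : ∀ t, Set.Iic t = Set.Icc b t := fun t ↦ by
    ext u
    exact ⟨fun h ↦ ⟨u.2.1, h⟩, fun h ↦ h.2⟩
  have huniv : Set.univ = Set.Icc b e := by
    ext u
    exact ⟨fun _ ↦ ⟨u.2.1, u.2.2⟩, fun _ ↦ trivial⟩
  refine VectorMeasure.ext_of_generateFrom (Set.range Set.Iic) ?_ ?_ isPiSystem_Iic ?_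
  · rintro _ ⟨t, rfl⟩
    rw [hIic, hIcc b t t.2.1]
  · rw [← borel_eq_generateFrom_Iic]
    exact BorelSpace.measurable_eq
  · rw [huniv, hIcc b e hT]

/-- Decomposing the regulator into parts that grow only at `1` and at `0` solves the Skorokhod
problem. -/
theorem isSkorokhodSolution_of_decomposition {T : ℝ} {a : ℝ} {v : Set.Icc (0 : ℝ) T → ℝ}
    {z : PathSpace T ℝ} {x : PathSpace T unitInterval} {k p n : PathSpace T ℝ}
    (hp : Monotone p) (hn : Monotone n) (hk : ∀ t, k t = p t - n t)
    (hcp : ∀ s t, s ≤ t → (∀ u ∈ Set.Icc s t, (x u : ℝ) < 1) → p t = p s)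
    (hcn : ∀ s t, s ≤ t → (∀ u ∈ Set.Icc s t, 0 < (x u : ℝ)) → n t = n s)
    (hx0 : ∀ t : Set.Icc (0 : ℝ) T, (t : ℝ) = 0 → (x t : ℝ) = a)
    (hk0 : ∀ t : Set.Icc (0 : ℝ) T, (t : ℝ) = 0 → k t = 0)
    (heqn : ∀ t, (x t : ℝ) = a + (∫ s in Set.Iic t, v s ∂timeMeasure T) + z t - k t) :
    IsSkorokhodSolution a v z x k := by
  have hxc : Continuous fun t ↦ (x t : ℝ) := continuous_subtype_val.comp x.continuous
  have bv : BoundedVariationOn (fun t ↦ k t) Set.univ :=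
    boundedVariationOn_of_eq_sub hp hn hk
  set μp := (monotoneStieltjes p hp).measure with hμp
  set μn := (monotoneStieltjes n hn).measure with hμn
  have hop : IsOpen {t | (x t : ℝ) < 1} := isOpen_lt hxc continuous_const
  have hon : IsOpen {t | 0 < (x t : ℝ)} := isOpen_lt continuous_const hxc
  have hp0 : μp {t | (x t : ℝ) < 1} = 0 := monotoneStieltjes_null p hp hop hcp
  have hn0 : μn {t | 0 < (x t : ℝ)} = 0 := monotoneStieltjes_null n hn hon hcn
  have hp1 : ∀ᵐ t ∂μp, (x t : ℝ) = 1 := by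
    rw [ae_iff]
    refine measure_mono_null (fun t ht ↦ ?_) hp0
    exact lt_of_le_of_ne (x t).2.2 ht
  have hn1 : ∀ᵐ t ∂μn, (x t : ℝ) = 0 := by
    rw [ae_iff]
    refine measure_mono_null (fun t ht ↦ ?_) hn0
    exact lt_of_le_of_ne (x t).2.1 (Ne.symm ht)
  -- `μp` lives on `{x = 1}` and `μn` on `{x = 0}`, so the pair is the Jordan decomposition of `dk`.
  -- Both the boundary condition and the direction of reflection can then be read off from it.
  have hsing : μp ⟂ₘ μn := by
    refine ⟨{t | (x t : ℝ) < 1}, hop.measurableSet, hp0, measure_mono_null (fun t ht ↦ ?_) hn0⟩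
    have : 1 ≤ (x t : ℝ) := not_lt.1 ht
    exact zero_lt_one.trans_le this
  have hst := stieltjes_eq_sub hp hn hk bv
  have hjd : (stieltjes bv).toJordanDecomposition = ⟨μp, μn, hsing⟩ :=
    SignedMeasure.toJordanDecomposition_eq hst
  have htv : (stieltjes bv).totalVariation = μp + μn := by
    rw [SignedMeasure.totalVariation, hjd]
  have hmeas : Measurable fun t ↦ outerNormal (x t) := by
    have : Measurable outerNormal := by
      unfold outerNormal
      exact Measurable.ite (measurableSet_singleton 0) measurable_const
        (Measurable.ite (measurableSet_singleton 1) measurable_const measurable_const)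
    exact this.comp hxc.measurable
  have hint : ∀ μ : Measure (Set.Icc (0 : ℝ) T), IsFiniteMeasure μ →
      Integrable (fun t ↦ outerNormal (x t)) μ := fun μ _ ↦ by
    refine Integrable.of_bound hmeas.aestronglyMeasurable 1 (ae_of_all _ fun t ↦ ?_)
    unfold outerNormal
    split_ifs <;> norm_num
  refine ⟨hx0, hk0, heqn, bv, ?_, ?_⟩
  · rw [htv]
    refine (Measure.restrict_eq_self_of_ae_mem ?_).symm
    rw [ae_add_measure_iff]
    exact ⟨hp1.mono fun t h ↦ Or.inr h, hn1.mono fun t h ↦ Or.inl h⟩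
  · rw [htv, hst]
    ext A hA
    rw [withDensityᵥ_apply (hint _ inferInstance) hA, Measure.restrict_add,
      integral_add_measure (hint _ inferInstance) (hint _ inferInstance), sub_apply,
      Measure.toSignedMeasure_apply_measurable hA, Measure.toSignedMeasure_apply_measurable hA]
    have e1 : ∫ t in A, outerNormal (x t) ∂μp = ∫ t in A, 1 ∂μp :=
      integral_congr_ae (ae_restrict_of_ae (hp1.mono fun t ht ↦ by simp [outerNormal, ht]))
    have e2 : ∫ t in A, outerNormal (x t) ∂μn = ∫ t in A, -1 ∂μn :=
      integral_congr_ae (ae_restrict_of_ae (hn1.mono fun t ht ↦ by simp [outerNormal, ht]))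
    rw [e1, e2]
    simp [sub_eq_add_neg, hμp, hμn]

/-- The path of the reflection problem with input `y`, when `y` starts in `[0,1]`. -/
theorem exists_reflection {T : ℝ} (y : PathSpace T ℝ)
    (h0 : ∀ t : Set.Icc (0 : ℝ) T, (t : ℝ) = 0 → y t ∈ Set.Icc (0 : ℝ) 1) :
    ∃ (x : PathSpace T unitInterval) (k p n : PathSpace T ℝ), IsReflected y x k ∧
      Monotone p ∧ Monotone n ∧ (∀ t, k t = p t - n t) ∧
      (∀ s t, s ≤ t → (∀ u ∈ Set.Icc s t, (x u : ℝ) < 1) → p t = p s) ∧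
      (∀ s t, s ≤ t → (∀ u ∈ Set.Icc s t, 0 < (x u : ℝ)) → n t = n s) := by
  -- For `T < 0` there are no times, and all conditions are vacuous.
  rcases isEmpty_or_nonempty (Set.Icc (0 : ℝ) T) with hemp | ⟨⟨t₀⟩⟩
  · refine ⟨ContinuousMap.const _ 0, 0, 0, 0, ⟨?_, ?_, ?_, ?_⟩, ?_, ?_, ?_, ?_, ?_⟩ <;>
      exact fun t ↦ hemp.elim t
  have hT : (0 : ℝ) ≤ T := t₀.2.1.trans t₀.2.2
  let Y : ℝ → ℝ := Set.IccExtend hT y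
  have hY : UniformContinuous Y :=
    (CompactSpace.uniformContinuous_of_continuous y.continuous).comp
      (LipschitzWith.projIcc hT).uniformContinuous
  have hYt : ∀ t : Set.Icc (0 : ℝ) T, Y t = y t := fun t ↦ Set.IccExtend_val hT _ t
  obtain ⟨P, N, H⟩ := exists_isRegulatorOn hY (by
    rw [show Y 0 = y ⟨0, le_rfl, hT⟩ from hYt ⟨0, le_rfl, hT⟩]
    exact h0 _ rfl) T
  have hmem : ∀ t : Set.Icc (0 : ℝ) T, y t - P t + N t ∈ Set.Icc (0 : ℝ) 1 := fun t ↦ by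
    rw [← hYt]; exact H.mem t t.2
  have hP := H.cont_p
  have hN := H.cont_n
  let x : PathSpace T unitInterval := ⟨fun t ↦ ⟨y t - P t + N t, hmem t⟩, by fun_prop⟩
  let p : PathSpace T ℝ := ⟨fun t ↦ P t, by fun_prop⟩
  let n : PathSpace T ℝ := ⟨fun t ↦ N t, by fun_prop⟩
  have hpm : Monotone p := fun s t hst ↦ H.mono_p hst
  have hnm : Monotone n := fun s t hst ↦ H.mono_n hst
  have hxt : ∀ t : Set.Icc (0 : ℝ) T, (x t : ℝ) = Y t - P t + N t := fun t ↦ by rw [hYt]; rfl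
  have hpc : ∀ s t, s ≤ t → (∀ u ∈ Set.Icc s t, (x u : ℝ) < 1) → p t = p s :=
    fun s t hst hu ↦ H.const_p s t s.2.1 hst t.2.2 fun u hu' ↦ by
      have := hu ⟨u, s.2.1.trans hu'.1, hu'.2.trans t.2.2⟩ ⟨hu'.1, hu'.2⟩
      rwa [hxt] at this
  have hnc : ∀ s t, s ≤ t → (∀ u ∈ Set.Icc s t, 0 < (x u : ℝ)) → n t = n s :=
    fun s t hst hu ↦ H.const_n s t s.2.1 hst t.2.2 fun u hu' ↦ by
      have := hu ⟨u, s.2.1.trans hu'.1, hu'.2.trans t.2.2⟩ ⟨hu'.1, hu'.2⟩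
      rwa [hxt] at this
  refine ⟨x, p - n, p, n, ⟨fun t ht ↦ ?_, fun t ↦ ?_, fun s t hst hu ↦ ?_, fun s t hst hu ↦ ?_⟩,
    hpm, hnm, fun t ↦ rfl, hpc, hnc⟩
  · change P t - N t = 0
    rw [ht, H.init_p, H.init_n, sub_zero]
  · change y t - P t + N t = y t - (P t - N t)
    ring
  · exact sub_le_sub (hpc s t hst hu).le (hnm hst)
  · exact sub_le_sub (hpm hst) (hnc s t hst hu).le

/-- Solutions of the order-theoretic reflection problem solve the Skorokhod problem. -/
theorem IsReflected.isSkorokhodSolution {T : ℝ} {a : ℝ} {v : Set.Icc (0 : ℝ) T → ℝ}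
    {z y : PathSpace T ℝ} {x : PathSpace T unitInterval} {k : PathSpace T ℝ}
    (h : IsReflected y x k) (ha : a ∈ Set.Icc (0 : ℝ) 1)
    (hy0 : ∀ t : Set.Icc (0 : ℝ) T, (t : ℝ) = 0 → y t = a)
    (hy : ∀ t, y t = a + (∫ s in Set.Iic t, v s ∂timeMeasure T) + z t) :
    IsSkorokhodSolution a v z x k := by
  -- `IsReflected` carries no decomposition of `k` into monotone parts. The constructed solution for
  -- the same `y` has one, and uniqueness transfers it.
  obtain ⟨x', k', p, n, h', hp, hn, hk, hpc, hnc⟩ := exists_reflection y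
    fun t ht ↦ by rw [hy0 t ht]; exact ha
  obtain ⟨rfl, rfl⟩ := h.unique h'
  exact isSkorokhodSolution_of_decomposition hp hn hk hpc hnc
    (fun t ht ↦ by rw [h.eqn, hy0 t ht, h.init t ht, sub_zero]) h.init
    fun t ↦ by rw [h.eqn, hy]


/-! ### Volterra equations -/

instance isFiniteMeasure_timeMeasure (T : ℝ) : IsFiniteMeasure (timeMeasure T) := by
  refine ⟨?_⟩
  rw [timeMeasure, (MeasurableEmbedding.subtype_coe measurableSet_Icc).comap_apply]
  exact (measure_mono (Set.image_subset_iff.2 fun x _ ↦ x.2)).trans_lt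
    (measure_Icc_lt_top (a := (0 : ℝ)) (b := T))

theorem setIntegral_timeMeasure {T : ℝ} (F : ℝ → ℝ) (t : Set.Icc (0 : ℝ) T) :
    ∫ s in Set.Iic t, F s ∂timeMeasure T = ∫ s in (0 : ℝ)..t, F s := by
  rw [intervalIntegral.integral_of_le t.2.1, ← integral_Icc_eq_integral_Ioc,
    ← integral_indicator measurableSet_Iic, ← integral_indicator measurableSet_Icc]
  have h : ∀ s : Set.Icc (0 : ℝ) T, (Set.Iic t).indicator (fun s ↦ F (s : ℝ)) s =
      (Set.Icc 0 (t : ℝ)).indicator F s := fun s ↦ by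
    by_cases hs : s ≤ t
    · rw [Set.indicator_of_mem (s := Set.Iic t) hs, Set.indicator_of_mem (show (s : ℝ) ∈ Set.Icc 0 (t : ℝ) from ⟨s.2.1, hs⟩)]
    · rw [Set.indicator_of_notMem (s := Set.Iic t) hs, Set.indicator_of_notMem fun h ↦ hs h.2]
  simp_rw [h, timeMeasure]
  rw [integral_subtype_comap measurableSet_Icc, setIntegral_eq_integral_of_forall_compl_eq_zero]
  intro s hs
  exact Set.indicator_of_notMem (fun h ↦ hs ⟨h.1, h.2.trans t.2.2⟩) _

theorem continuous_setIntegral_timeMeasure {T : ℝ} (v : PathSpace T ℝ) :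
    Continuous fun t ↦ ∫ s in Set.Iic t, v s ∂timeMeasure T := by
  rcases isEmpty_or_nonempty (Set.Icc (0 : ℝ) T) with hemp | ⟨⟨t₀⟩⟩
  · exact continuous_of_discreteTopology
  have hT : (0 : ℝ) ≤ T := t₀.2.1.trans t₀.2.2
  have hc : Continuous (Set.IccExtend hT v) := v.continuous.Icc_extend'
  have h : ∀ t : Set.Icc (0 : ℝ) T, ∫ s in Set.Iic t, v s ∂timeMeasure T =
      ∫ s in (0 : ℝ)..t, Set.IccExtend hT v s := fun t ↦ by
    rw [← setIntegral_timeMeasure]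
    simp_rw [Set.IccExtend_val]
  simp_rw [h]
  exact (intervalIntegral.continuous_primitive (fun a b ↦ hc.intervalIntegrable a b) 0).comp
    continuous_subtype_val

/-- The primitive of a continuous path. -/
def primitive {T : ℝ} (v : PathSpace T ℝ) : PathSpace T ℝ :=
  ⟨fun t ↦ ∫ s in Set.Iic t, v s ∂timeMeasure T, continuous_setIntegral_timeMeasure v⟩

theorem primitive_apply {T : ℝ} (v : PathSpace T ℝ) (t : Set.Icc (0 : ℝ) T) :
    primitive v t = ∫ s in Set.Iic t, v s ∂timeMeasure T := rfl

theorem integrable_path {T : ℝ} (v : PathSpace T ℝ) (μ : Measure (Set.Icc (0 : ℝ) T))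
    [IsFiniteMeasure μ] : Integrable v μ :=
  v.continuous.integrable_of_hasCompactSupport (HasCompactSupport.of_compactSpace _)

theorem primitive_sub {T : ℝ} (v w : PathSpace T ℝ) :
    primitive (v - w) = primitive v - primitive w := by
  ext t
  exact integral_sub (integrable_path v _) (integrable_path w _)

theorem primitive_zero_time {T : ℝ} (v : PathSpace T ℝ) (t : Set.Icc (0 : ℝ) T)
    (ht : (t : ℝ) = 0) : primitive v t = 0 := by
  have hT : (0 : ℝ) ≤ T := t.2.1.trans t.2.2
  have := setIntegral_timeMeasure (Set.IccExtend hT v) t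
  simp_rw [Set.IccExtend_val] at this
  rw [primitive_apply, this, ht, intervalIntegral.integral_same]

theorem abs_primitive_le {T : ℝ} (v : PathSpace T ℝ) (t : Set.Icc (0 : ℝ) T) :
    |primitive v t| ≤ primitive |v| t :=
  abs_integral_le_integral_abs

theorem primitive_mono {T : ℝ} {v w : PathSpace T ℝ} {t : Set.Icc (0 : ℝ) T}
    (h : ∀ s ≤ t, v s ≤ w s) : primitive v t ≤ primitive w t :=
  setIntegral_mono_on (integrable_path v _).integrableOn (integrable_path w _).integrableOn
    measurableSet_Iic h

theorem primitive_le_of_le {T : ℝ} {v : PathSpace T ℝ} (hv : 0 ≤ v) {s t : Set.Icc (0 : ℝ) T}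
    (hst : s ≤ t) : primitive v s ≤ primitive v t :=
  setIntegral_mono_set (integrable_path v _).integrableOn (ae_of_all _ hv)
    (Set.Iic_subset_Iic.2 hst).eventuallyLE

theorem primitive_nonneg {T : ℝ} {v : PathSpace T ℝ} (hv : 0 ≤ v) (t : Set.Icc (0 : ℝ) T) :
    0 ≤ primitive v t :=
  integral_nonneg hv

theorem primitive_le_integral {T : ℝ} {v : PathSpace T ℝ} (hv : 0 ≤ v) (t : Set.Icc (0 : ℝ) T) :
    primitive v t ≤ ∫ s, v s ∂timeMeasure T :=
  setIntegral_le_integral (integrable_path v _) (ae_of_all _ hv)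

theorem primitive_smul {T : ℝ} (c : ℝ) (v : PathSpace T ℝ) : primitive (c • v) = c • primitive v := by
  ext t
  exact integral_const_mul c _

/-- The path `t ↦ exp (α t)`. -/
def expPath (T α : ℝ) : PathSpace T ℝ := ⟨fun t ↦ Real.exp (α * t), by fun_prop⟩

theorem primitive_expPath_le {T α : ℝ} (hα : 0 < α) (t : Set.Icc (0 : ℝ) T) :
    primitive (expPath T α) t ≤ Real.exp (α * t) / α := by
  change ∫ s in Set.Iic t, Real.exp (α * s) ∂timeMeasure T ≤ _
  rw [setIntegral_timeMeasure (fun s ↦ Real.exp (α * s)),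
    intervalIntegral.integral_comp_mul_left (fun s ↦ Real.exp s) hα.ne', integral_exp, mul_zero,
    Real.exp_zero, smul_eq_mul, inv_mul_eq_div]
  gcongr
  linarith

/-- An integral form of Grönwall's inequality. -/
theorem gronwall_path {T : ℝ} {u : PathSpace T ℝ} {C e : ℝ} (hC : 0 < C)
    {t₁ : Set.Icc (0 : ℝ) T} (hu : ∀ t ≤ t₁, u t ≤ e + C * primitive u t) (he : 0 ≤ e) :
    ∀ t ≤ t₁, u t ≤ 2 * Real.exp (2 * C * T) * e := by
  have hα : 0 < 2 * C := by positivity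
  have hcont : Continuous fun t : Set.Icc (0 : ℝ) T ↦ Real.exp (-(2 * C * t)) * u t := by fun_prop
  -- At the maximiser `t'` of `exp (-2Ct) u t`, the integral term is at most half of `u t'` when the
  -- maximum is positive, because the rate is `2C`. It can therefore be absorbed.
  obtain ⟨t', ht', hmax⟩ := (isClosed_Iic.isCompact (X := Set.Icc (0 : ℝ) T) (s := Set.Iic t₁)).exists_isMaxOn
    ⟨t₁, le_refl t₁⟩ hcont.continuousOn
  set S := Real.exp (-(2 * C * t')) * u t' with hS
  have hle : ∀ s ≤ t₁, u s ≤ S * Real.exp (2 * C * s) := fun s hs ↦ by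
    have h1 : Real.exp (-(2 * C * s)) * u s ≤ S := hmax hs
    rw [Real.exp_neg, inv_mul_le_iff₀ (Real.exp_pos _)] at h1
    linarith
  have hS2 : S ≤ 2 * e := by
    by_contra! hlt
    have hS0 : 0 < S := by linarith
    have h1 : primitive u t' ≤ S * (Real.exp (2 * C * t') / (2 * C)) := by
      refine (primitive_mono (w := S • expPath T (2 * C)) fun s hs ↦ hle s (hs.trans ht')).trans ?_
      rw [primitive_smul]
      exact mul_le_mul_of_nonneg_left (primitive_expPath_le hα t') hS0.le
    have h2 := hu t' ht'
    have h3 : u t' = S * Real.exp (2 * C * t') := by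
      rw [hS, mul_right_comm, ← Real.exp_add]; simp
    have h4 : 1 ≤ Real.exp (2 * C * t') := Real.one_le_exp (mul_nonneg hα.le t'.2.1)
    have h5 : C * (S * (Real.exp (2 * C * t') / (2 * C))) = S * Real.exp (2 * C * t') / 2 := by
      field_simp
    have h6 := mul_le_mul_of_nonneg_left h1 hC.le
    rw [h5] at h6
    rw [h3] at h2
    nlinarith
  intro t ht
  have h7 : Real.exp (2 * C * t) ≤ Real.exp (2 * C * T) :=
    Real.exp_le_exp.2 (mul_le_mul_of_nonneg_left t.2.2 hα.le)
  calc u t ≤ S * Real.exp (2 * C * t) := hle t ht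
    _ ≤ 2 * e * Real.exp (2 * C * t) := by gcongr
    _ ≤ 2 * e * Real.exp (2 * C * T) := by gcongr
    _ = _ := by ring

/-- A Volterra-type map on the path space has a fixed point. -/
theorem exists_fixedPoint_of_volterra {T : ℝ} (G : PathSpace T ℝ → PathSpace T ℝ) {C : ℝ}
    (hC : 0 < C) (hG : ∀ f g t, |G f t - G g t| ≤ C * primitive |f - g| t) : ∃ f, G f = f := by
  have hα : 0 < 2 * C := by positivity
  let w := expPath T (2 * C)
  let w' := expPath T (-(2 * C))
  have hw : ∀ t, w t * w' t = 1 := fun t ↦ by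
    change Real.exp _ * Real.exp _ = 1
    rw [← Real.exp_add]; simp
  have hw1 : w * w' = 1 := by ext t; exact hw t
  -- Conjugation with the weight `exp (2Ct)` turns the Volterra bound into a contraction with factor
  -- 1/2 in the supremum norm, on the whole interval at once.
  let H : PathSpace T ℝ → PathSpace T ℝ := fun f ↦ w' * G (w * f)
  have hH : ContractingWith (1 / 2) H := by
    refine ⟨by norm_num, LipschitzWith.of_dist_le_mul fun f g ↦ ?_⟩
    rw [ContinuousMap.dist_le (by positivity)]
    intro t
    have h1 : primitive |w * f - w * g| t ≤ dist f g * (Real.exp (2 * C * t) / (2 * C)) := by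
      refine (primitive_mono (w := dist f g • w) fun s _ ↦ ?_).trans ?_
      · change |w s * f s - w s * g s| ≤ dist f g * w s
        rw [← mul_sub, abs_mul, abs_of_pos (show 0 < w s from Real.exp_pos _), mul_comm]
        exact mul_le_mul_of_nonneg_right (ContinuousMap.dist_apply_le_dist (f := f) (g := g) s) (Real.exp_pos _).le
      · rw [primitive_smul]
        exact mul_le_mul_of_nonneg_left (primitive_expPath_le hα t) dist_nonneg
    have h2 : 0 < w' t := Real.exp_pos _
    have h3 : w t = Real.exp (2 * C * t) := rfl
    rw [← h3] at h1
    calc dist (H f t) (H g t) = w' t * |G (w * f) t - G (w * g) t| := by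
          rw [Real.dist_eq]
          change |w' t * _ - w' t * _| = _
          rw [← mul_sub, abs_mul, abs_of_pos h2]
      _ ≤ w' t * (C * (dist f g * (w t / (2 * C)))) := by
          gcongr
          exact (hG _ _ t).trans (by gcongr)
      _ = (w t * w' t) * dist f g / 2 := by field_simp
      _ = _ := by rw [hw]; simp; ring
  refine ⟨w * hH.fixedPoint, ?_⟩
  have h := hH.fixedPoint_isFixedPt
  change w' * G (w * hH.fixedPoint) = hH.fixedPoint at h
  conv_rhs => rw [← h]
  rw [← mul_assoc, hw1, one_mul]


/-! ### The response of one particle to a given surface potential -/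

/-- The value of a path at time `0`. -/
def initialValue {T : ℝ} (w : PathSpace T ℝ) : ℝ := if h : 0 ≤ T then w ⟨0, le_rfl, h⟩ else 0

theorem initialValue_eq {T : ℝ} (w : PathSpace T ℝ) {t : Set.Icc (0 : ℝ) T} (ht : (t : ℝ) = 0) :
    initialValue w = w t := by
  have hT : 0 ≤ T := t.2.1.trans t.2.2
  rw [initialValue, dif_pos hT]
  congr 1
  exact Subtype.ext ht.symm

theorem continuous_initialValue {T : ℝ} : Continuous (initialValue (T := T)) := by
  unfold initialValue
  split_ifs
  · exact ContinuousEvalConst.continuous_eval_const _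
  · exact continuous_const

/-- A path, translated so that it starts at `0`. -/
def centered {T : ℝ} (w : PathSpace T ℝ) : PathSpace T ℝ := w - ContinuousMap.const _ (initialValue w)

theorem continuous_centered {T : ℝ} : Continuous (centered (T := T)) :=
  continuous_id.sub (ContinuousMap.continuous_const'.comp continuous_initialValue)

theorem centered_zero_time {T : ℝ} (w : PathSpace T ℝ) {t : Set.Icc (0 : ℝ) T}
    (ht : (t : ℝ) = 0) : centered w t = 0 := by
  change w t - initialValue w = 0
  rw [initialValue_eq w ht, sub_self]

/-- A `[0,1]`-valued path as a real path. -/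
def realPath {T : ℝ} (x : PathSpace T unitInterval) : PathSpace T ℝ :=
  ⟨fun t ↦ x t, continuous_subtype_val.comp x.continuous⟩

namespace Model

variable {T : ℝ} (M : Model T)

theorem continuous_μLi : Continuous M.μLi := M.μLi_lipschitz.choose_spec.continuous

theorem continuous_σ : Continuous M.σ := M.σ_lipschitz.choose_spec.continuous

theorem continuous_τ_inv : Continuous fun r ↦ (M.τ r)⁻¹ := M.τ_inv_lipschitz.choose_spec.continuous

/-- The chemical potential along a path. -/
def μPath (Y : PathSpace T ℝ) : PathSpace T ℝ :=
  ⟨fun t ↦ M.μLi (Y t), M.continuous_μLi.comp Y.continuous⟩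

/-- The unreflected path of a particle with radius and noise `p`, surface potential `Λ` and mole
fraction `Y`. -/
def driver (Λ : PathSpace T ℝ) (p : M.Radius × PathSpace T ℝ) (Y : PathSpace T ℝ) :
    PathSpace T ℝ :=
  ContinuousMap.const _ M.a + (M.τ p.1)⁻¹ • primitive (Λ - M.μPath Y) + M.σ p.1 • centered p.2

theorem driver_apply (Λ : PathSpace T ℝ) (p : M.Radius × PathSpace T ℝ) (Y : PathSpace T ℝ)
    (t : Set.Icc (0 : ℝ) T) : M.driver Λ p Y t =
      M.a + (M.τ p.1)⁻¹ * primitive (Λ - M.μPath Y) t + M.σ p.1 * centered p.2 t := rfl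

/-- Centering the noise makes this true for every path, so the response is defined on all of path
space. Brownian paths start at 0 almost surely, and there centering changes nothing. -/
theorem driver_zero_time (Λ : PathSpace T ℝ) (p : M.Radius × PathSpace T ℝ) (Y : PathSpace T ℝ)
    {t : Set.Icc (0 : ℝ) T} (ht : (t : ℝ) = 0) : M.driver Λ p Y t = M.a := by
  rw [driver_apply, primitive_zero_time _ t ht, centered_zero_time _ ht]
  simp

theorem continuous_driver (Λ Y : PathSpace T ℝ) : Continuous fun p ↦ M.driver Λ p Y := by
  unfold driver
  have h1 := M.continuous_τ_inv
  have h2 := M.continuous_σ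
  have h3 := continuous_centered (T := T)
  exact (continuous_const.add ((h1.comp continuous_fst).smul continuous_const)).add
    ((h2.comp continuous_fst).smul (h3.comp continuous_snd))

/-- The mobilities `1/τ` are bounded. -/
theorem exists_mobility_bound : ∃ C, 0 < C ∧ ∀ r, |(M.τ r)⁻¹| ≤ C := by
  obtain ⟨C, hC⟩ := M.τ_inv_bounded
  exact ⟨max C 1, lt_max_of_lt_right one_pos, fun r ↦ (hC r).trans (le_max_left _ _)⟩

theorem exists_driver_lipschitz : ∃ B, 0 < B ∧ ∀ Λ p Y Y' t,
    |M.driver Λ p Y t - M.driver Λ p Y' t| ≤ B * primitive |Y - Y'| t := by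
  obtain ⟨C, hC0, hC⟩ := M.exists_mobility_bound
  obtain ⟨L, hL⟩ := M.μLi_lipschitz
  -- `L` may be 0; adding 1 keeps the constant positive.
  refine ⟨C * (L + 1), by positivity, fun Λ p Y Y' t ↦ ?_⟩
  have h1 : M.driver Λ p Y t - M.driver Λ p Y' t =
      (M.τ p.1)⁻¹ * primitive (M.μPath Y' - M.μPath Y) t := by
    rw [driver_apply, driver_apply, primitive_sub, primitive_sub, primitive_sub]
    simp only [ContinuousMap.sub_apply]
    ring
  rw [h1, abs_mul, mul_assoc]
  refine mul_le_mul (hC _) ((abs_primitive_le _ t).trans ?_) (abs_nonneg _) hC0.le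
  rw [← smul_eq_mul (L + 1 : ℝ), ← ContinuousMap.smul_apply, ← primitive_smul]
  refine primitive_mono fun s _ ↦ ?_
  change |M.μLi (Y' s) - M.μLi (Y s)| ≤ (L + 1) * |Y s - Y' s|
  have h2 := hL.dist_le_mul (Y' s) (Y s)
  rw [Real.dist_eq, Real.dist_eq, abs_sub_comm (Y' s)] at h2
  linarith [abs_nonneg (Y s - Y' s)]

/-- A fixed point of the map sending a mole fraction to the reflection of the driver it produces.
Reflection is 2-Lipschitz on each `[0,t]`, so the map is of Volterra type with constant `2 * B`. -/
theorem exists_response (Λ : PathSpace T ℝ) (p : M.Radius × PathSpace T ℝ) :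
    ∃ Z : StatePath T, IsReflected (M.driver Λ p (realPath Z.1)) Z.1 Z.2 := by
  choose x k _ _ hxk _ using fun Y ↦ exists_reflection (M.driver Λ p Y)
    fun t ht ↦ by rw [M.driver_zero_time Λ p Y ht]; exact M.a_mem
  obtain ⟨B, hB, hd⟩ := M.exists_driver_lipschitz
  obtain ⟨Y, hY⟩ := exists_fixedPoint_of_volterra (fun Y ↦ realPath (x Y)) (C := 2 * B)
    (by positivity) fun f g t ↦ by
      rw [mul_assoc]
      refine (hxk f).abs_sub_le (hxk g) fun s hs ↦ (hd Λ p f g s).trans ?_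
      exact mul_le_mul_of_nonneg_left (primitive_le_of_le (abs_nonneg (f - g)) hs) hB.le
  refine ⟨(x Y, k Y), ?_⟩
  have := hxk Y
  rw [← hY] at this
  simpa only [hY] using this

/-- The mole fraction and the reflection term of a particle with radius and noise `p`, when the
surface potential is `Λ`. -/
def response (Λ : PathSpace T ℝ) (p : M.Radius × PathSpace T ℝ) : StatePath T :=
  (M.exists_response Λ p).choose

theorem isReflected_response (Λ : PathSpace T ℝ) (p : M.Radius × PathSpace T ℝ) :
    IsReflected (M.driver Λ p (realPath (M.response Λ p).1)) (M.response Λ p).1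
      (M.response Λ p).2 :=
  (M.exists_response Λ p).choose_spec

/-- The two drivers are compared only along the common path `Z'`; the feedback of `Z - Z'` is left
to Grönwall. Uniqueness (`D = 0`), Lipschitz dependence on `Λ` and continuity in `p` all follow from
this one estimate. -/
theorem exists_stability : ∃ K, 0 < K ∧ ∀ Λ Λ' p p' (Z Z' : StatePath T) t₁ D, 0 ≤ D →
    IsReflected (M.driver Λ p (realPath Z.1)) Z.1 Z.2 →
    IsReflected (M.driver Λ' p' (realPath Z'.1)) Z'.1 Z'.2 →
    (∀ s ≤ t₁, |M.driver Λ p (realPath Z'.1) s - M.driver Λ' p' (realPath Z'.1) s| ≤ D) →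
    |(Z.1 t₁ : ℝ) - Z'.1 t₁| ≤ K * D ∧ |Z.2 t₁ - Z'.2 t₁| ≤ K * D := by
  obtain ⟨B, hB, hd⟩ := M.exists_driver_lipschitz
  -- Grönwall is used with rate `2 * B` and defect `2 * D`, both doubled by the 2-Lipschitz
  -- reflection. The regulator is 1-Lipschitz and costs `D + B ∫ u`, which explains the other entry
  -- of the maximum below.
  set K₁ := 2 * Real.exp (2 * (2 * B) * T) * 2 with hK₁
  have hK₁0 : 0 < K₁ := by positivity
  set m := ∫ _, (1 : ℝ) ∂timeMeasure T with hm
  have hm0 : 0 ≤ m := integral_nonneg fun _ ↦ zero_le_one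
  refine ⟨max K₁ (1 + B * (K₁ * m)), lt_max_of_lt_left hK₁0,
    fun Λ Λ' p p' Z Z' t₁ D hD h h' hdr ↦ ?_⟩
  set u : PathSpace T ℝ := |realPath Z.1 - realPath Z'.1| with hu
  have hu0 : 0 ≤ u := abs_nonneg _
  have hdiff : ∀ t ≤ t₁, ∀ s ≤ t, |M.driver Λ p (realPath Z.1) s -
      M.driver Λ' p' (realPath Z'.1) s| ≤ D + B * primitive u t := fun t ht s hs ↦ by
    have h1 := hd Λ p (realPath Z.1) (realPath Z'.1) s
    have h2 := hdr s (hs.trans ht)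
    have h3 := mul_le_mul_of_nonneg_left (primitive_le_of_le hu0 hs) hB.le
    have h4 := abs_sub_le (M.driver Λ p (realPath Z.1) s) (M.driver Λ p (realPath Z'.1) s)
      (M.driver Λ' p' (realPath Z'.1) s)
    linarith
  have hgr : ∀ t ≤ t₁, u t ≤ K₁ * D := fun t ht ↦ by
    have h1 := gronwall_path (u := u) (C := 2 * B) (e := 2 * D) (t₁ := t₁) (by positivity)
      (fun t ht ↦ by
        have h2 : u t ≤ 2 * (D + B * primitive u t) := h.abs_sub_le h' (hdiff t ht)
        linarith) (by positivity) t ht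
    rw [hK₁]
    linarith
  constructor
  · exact (hgr t₁ le_rfl).trans (mul_le_mul_of_nonneg_right (le_max_left _ _) hD)
  · refine (h.abs_regulator_sub_le h' (hdiff t₁ le_rfl)).trans ?_
    have h1 : primitive u t₁ ≤ K₁ * D * m := by
      refine (primitive_mono (w := (K₁ * D) • (1 : PathSpace T ℝ)) fun s hs ↦ ?_).trans ?_
      · simpa using hgr s hs
      · rw [primitive_smul]
        exact mul_le_mul_of_nonneg_left (primitive_le_integral zero_le_one t₁) (by positivity)
    have h2 := mul_le_mul_of_nonneg_left h1 hB.le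
    have h3 := mul_le_mul_of_nonneg_right (le_max_right K₁ (1 + B * (K₁ * m))) hD
    linarith

theorem eq_response {Λ : PathSpace T ℝ} {p : M.Radius × PathSpace T ℝ} {Z : StatePath T}
    (h : IsReflected (M.driver Λ p (realPath Z.1)) Z.1 Z.2) : Z = M.response Λ p := by
  obtain ⟨K, -, hK⟩ := M.exists_stability
  have h0 := fun t ↦ hK Λ Λ p p Z (M.response Λ p) t 0 le_rfl h (M.isReflected_response Λ p)
    (by simp)
  simp only [mul_zero, abs_nonpos_iff, sub_eq_zero] at h0
  refine Prod.ext (ContinuousMap.ext fun t ↦ Subtype.ext (h0 t).1) (ContinuousMap.ext fun t ↦ (h0 t).2)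

/-- The response depends on the surface potential in a Lipschitz way, uniformly in the particle. -/
theorem exists_response_lipschitz : ∃ K, 0 < K ∧ ∀ Λ Λ' p t,
    |((M.response Λ p).1 t : ℝ) - (M.response Λ' p).1 t| ≤ K * primitive |Λ - Λ'| t ∧
    |(M.response Λ p).2 t - (M.response Λ' p).2 t| ≤ K * primitive |Λ - Λ'| t := by
  obtain ⟨C, hC0, hC⟩ := M.exists_mobility_bound
  obtain ⟨K, hK0, hK⟩ := M.exists_stability
  refine ⟨K * C, by positivity, fun Λ Λ' p t ↦ ?_⟩
  rw [mul_assoc]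
  have habs : 0 ≤ |Λ - Λ'| := abs_nonneg _
  refine hK Λ Λ' p p _ _ t _ (mul_nonneg hC0.le (primitive_nonneg habs t))
    (M.isReflected_response Λ p) (M.isReflected_response Λ' p) fun s hs ↦ ?_
  have h1 : ∀ Y, M.driver Λ p Y s - M.driver Λ' p Y s = (M.τ p.1)⁻¹ * primitive (Λ - Λ') s :=
    fun Y ↦ by
      rw [driver_apply, driver_apply, primitive_sub, primitive_sub, primitive_sub]
      simp only [ContinuousMap.sub_apply]
      ring
  rw [h1, abs_mul]
  exact mul_le_mul (hC _) ((abs_primitive_le _ s).trans (primitive_le_of_le habs hs))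
    (abs_nonneg _) hC0.le

theorem statePath_dist_le {Z Z' : StatePath T} {D : ℝ} (hD : 0 ≤ D)
    (h : ∀ t, |(Z.1 t : ℝ) - Z'.1 t| ≤ D ∧ |Z.2 t - Z'.2 t| ≤ D) : dist Z Z' ≤ D :=
  max_le ((ContinuousMap.dist_le hD).2 fun t ↦ (h t).1) ((ContinuousMap.dist_le hD).2 fun t ↦ (h t).2)

/-- Only the `L¹` distance of the potentials enters, and that is what dominated convergence will
control. -/
theorem exists_response_dist_le : ∃ K, 0 < K ∧ ∀ Λ Λ' p,
    dist (M.response Λ p) (M.response Λ' p) ≤ K * ∫ s, |Λ s - Λ' s| ∂timeMeasure T := by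
  obtain ⟨K, hK0, hK⟩ := M.exists_response_lipschitz
  refine ⟨K, hK0, fun Λ Λ' p ↦ statePath_dist_le ?_ fun t ↦ ?_⟩
  · exact mul_nonneg hK0.le (integral_nonneg fun _ ↦ abs_nonneg _)
  · have h := mul_le_mul_of_nonneg_left
      (primitive_le_integral (v := |Λ - Λ'|) (abs_nonneg (Λ - Λ')) t) hK0.le
    exact ⟨(hK Λ Λ' p t).1.trans h, (hK Λ Λ' p t).2.trans h⟩

/-- In the stability estimate the drivers are compared along the path at `p₀`, which stays fixed as
`p` moves. Continuity of the driver in `p` is then enough. -/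
theorem continuous_response (Λ : PathSpace T ℝ) : Continuous (M.response Λ) := by
  obtain ⟨K, hK0, hK⟩ := M.exists_stability
  refine continuous_iff_continuousAt.2 fun p₀ ↦ ?_
  set Y := realPath (M.response Λ p₀).1 with hY
  have hlim : Tendsto (fun p ↦ K * dist (M.driver Λ p Y) (M.driver Λ p₀ Y)) (𝓝 p₀) (𝓝 0) := by
    have := ((M.continuous_driver Λ Y).tendsto p₀).dist (tendsto_const_nhds (x := M.driver Λ p₀ Y))
    rw [dist_self] at this
    simpa using this.const_mul K
  refine tendsto_iff_dist_tendsto_zero.2 (squeeze_zero (fun _ ↦ dist_nonneg) (fun p ↦ ?_) hlim)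
  refine statePath_dist_le (mul_nonneg hK0.le dist_nonneg) fun t ↦
    hK Λ Λ p p₀ _ _ t _ dist_nonneg (M.isReflected_response Λ p) (M.isReflected_response Λ p₀)
      fun s _ ↦ ?_
  exact ContinuousMap.dist_apply_le_dist (f := M.driver Λ p Y) (g := M.driver Λ p₀ Y) s

/-- The Skorokhod problem of one particle with a given continuous surface potential is solved
exactly by the response. -/
theorem isSkorokhodSolution_iff {Λ : PathSpace T ℝ} {p : M.Radius × PathSpace T ℝ}
    {Z : StatePath T} {v : Set.Icc (0 : ℝ) T → ℝ} (hp : initialValue p.2 = 0)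
    (hv : ∀ s, v s = 1 / M.τ p.1 * (Λ s - M.μLi (Z.1 s))) :
    IsSkorokhodSolution M.a v (M.σ p.1 • p.2) Z.1 Z.2 ↔ Z = M.response Λ p := by
  have hy : ∀ t, M.driver Λ p (realPath Z.1) t =
      M.a + (∫ s in Set.Iic t, v s ∂timeMeasure T) + (M.σ p.1 • p.2) t := fun t ↦ by
    rw [driver_apply, primitive_apply, ← integral_const_mul]
    simp only [hv, one_div, centered, hp]
    simp [realPath, μPath]
  refine ⟨fun h ↦ M.eq_response (h.isReflected hy), fun h ↦ ?_⟩
  refine IsReflected.isSkorokhodSolution ?_ M.a_mem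
    (fun t ht ↦ M.driver_zero_time Λ p (realPath Z.1) ht) hy
  rw [h]
  exact M.isReflected_response Λ p

end Model


/-! ### Empirical measures -/

section Empirical

variable {E F : Type*} [MeasurableSpace E] [MeasurableSpace F] {n : ℕ} [NeZero n]

theorem empiricalMeasure_toMeasure (x : Fin n → E) :
    (empiricalMeasure x : Measure E) = (n : ℝ≥0∞)⁻¹ • ∑ i, Measure.dirac (x i) := rfl

theorem map_empiricalMeasure (x : Fin n → E) {f : E → F} (hf : Measurable f) :
    (empiricalMeasure x : Measure E).map f = empiricalMeasure fun i ↦ f (x i) := by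
  rw [empiricalMeasure_toMeasure, empiricalMeasure_toMeasure, Measure.map_smul,
    Measure.map_finset_sum hf.aemeasurable]
  simp_rw [Measure.map_dirac' hf]

theorem integral_empiricalMeasure [MeasurableSingletonClass E] (x : Fin n → E) (f : E → ℝ) :
    ∫ y, f y ∂(empiricalMeasure x : Measure E) = (n : ℝ)⁻¹ * ∑ i, f (x i) := by
  rw [empiricalMeasure_toMeasure, integral_smul_measure,
    integral_finsetSum_measure fun i _ ↦ integrable_dirac (by simp)]
  simp

/-- This is what makes the solution of the particle system a measurable function of the noises. -/
theorem continuous_empiricalMeasure [TopologicalSpace E] [OpensMeasurableSpace E]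
    [MeasurableSingletonClass E] :
    Continuous fun x : Fin n → E ↦ empiricalMeasure x := by
  refine continuous_iff_continuousAt.2 fun x ↦ ?_
  refine ProbabilityMeasure.tendsto_iff_forall_integral_tendsto.2 fun f ↦ ?_
  simp_rw [integral_empiricalMeasure]
  have : Continuous fun x : Fin n → E ↦ (n : ℝ)⁻¹ * ∑ i, f (x i) := by fun_prop
  exact this.tendsto x

end Empirical

namespace Model

variable {T : ℝ} (M : Model T)

/-! ### The self-consistent surface potential -/

/-- The conductivity weight `V/τ`. -/
def weight (r : M.Radius) : ℝ := M.vol r / M.τ r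

theorem continuous_vol : Continuous M.vol := by
  unfold vol
  fun_prop

theorem continuous_weight : Continuous M.weight := by
  unfold weight
  simp_rw [div_eq_mul_inv]
  exact M.continuous_vol.mul M.continuous_τ_inv

theorem weight_ne_zero (r : M.Radius) : M.weight r ≠ 0 := by
  have h : 0 < (r : ℝ) := M.rmin_pos.trans_le r.2.1
  have : 0 < M.vol r := by unfold vol; positivity
  exact div_ne_zero this.ne' (M.τ_ne_zero r)

/-- `τ` may have either sign, but it has no zero on a connected interval. The fixed sign prevents
cancellation in the denominator of the potential. -/
theorem weight_pos_or_neg : (∀ r, 0 < M.weight r) ∨ ∀ r, M.weight r < 0 := by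
  have : PreconnectedSpace M.Radius := Subtype.preconnectedSpace isPreconnected_Icc
  by_contra! h
  obtain ⟨⟨r, hr⟩, ⟨r', hr'⟩⟩ := h
  obtain ⟨r₀, h₀⟩ := intermediate_value_univ r r' M.continuous_weight ⟨hr, hr'⟩
  exact M.weight_ne_zero r₀ h₀

theorem exists_weight_bounds : ∃ c C, 0 < c ∧ 0 < C ∧
    ∀ r, c ≤ |M.weight r| ∧ |M.weight r| ≤ C ∧ |M.vol r| ≤ C := by
  rcases isEmpty_or_nonempty M.Radius with hemp | hne
  · exact ⟨1, 1, one_pos, one_pos, fun r ↦ hemp.elim r⟩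
  have hcw := M.continuous_weight.abs
  have hcv := M.continuous_vol.abs
  obtain ⟨r₀, -, h₀⟩ := isCompact_univ.exists_isMinOn Set.univ_nonempty hcw.continuousOn
  obtain ⟨r₁, -, h₁⟩ := isCompact_univ.exists_isMaxOn Set.univ_nonempty hcw.continuousOn
  obtain ⟨r₂, -, h₂⟩ := isCompact_univ.exists_isMaxOn Set.univ_nonempty hcv.continuousOn
  exact ⟨|M.weight r₀|, max |M.weight r₁| |M.vol r₂|, abs_pos.2 (M.weight_ne_zero r₀),
    lt_max_of_lt_left (abs_pos.2 (M.weight_ne_zero r₁)),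
    fun r ↦ ⟨h₀ (Set.mem_univ r), (h₁ (Set.mem_univ r)).trans (le_max_left _ _),
      (h₂ (Set.mem_univ r)).trans (le_max_right _ _)⟩⟩

/-- Positivity of `T` gives unique differentiability on the closed interval, hence continuity of the
derivative up to the end points. -/
theorem continuousOn_qdot (hT : 0 < T) : ContinuousOn M.qdot (Set.Icc 0 T) :=
  M.q_contDiff.continuousOn_derivWithin (uniqueDiffOn_Icc hT) le_rfl

theorem exists_numerator_bound (hT : 0 < T) : ∃ C, ∀ (s : Set.Icc (0 : ℝ) T) (x : ℝ) r,
    |M.vol r * M.qdot s + M.μLi x * M.weight r| ≤ C := by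
  obtain ⟨c, C, -, hC, h⟩ := M.exists_weight_bounds
  obtain ⟨Q, hQ⟩ := isCompact_Icc.exists_bound_of_continuousOn (M.continuousOn_qdot hT)
  obtain ⟨B, hB⟩ := M.μLi_bounded
  refine ⟨C * Q + B * C, fun s x r ↦ (abs_add_le _ _).trans (add_le_add ?_ ?_)⟩
  · rw [abs_mul]
    exact mul_le_mul (h r).2.2 (hQ s s.2) (abs_nonneg _) hC.le
  · rw [abs_mul]
    exact mul_le_mul (hB x) (h r).2.1 (abs_nonneg _) ((abs_nonneg _).trans (hB x))

/-! ### The potential under a general law: continuity in time, bounds and Lipschitz dependence. -/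

section Potential

variable {Ω : Type*} [MeasurableSpace Ω] (P : Measure Ω)
  {Z : Ω → StatePath T} {R : Ω → M.Radius}

theorem measurable_eval_state (s : Set.Icc (0 : ℝ) T) :
    Measurable fun z : StatePath T ↦ z.1 s :=
  (ContinuousEvalConst.continuous_eval_const s).measurable.comp measurable_fst

/-- Written as expectations on `Ω`, potentials of two processes on the same space can be compared
pointwise. -/
theorem potential_map (hZ : Measurable Z) (hR : Measurable R) (s : Set.Icc (0 : ℝ) T) :
    M.potential s (P.map fun ω ↦ ((Z ω).1 s, R ω)) =
      (∫ ω, (M.vol (R ω) * M.qdot s + M.μLi ((Z ω).1 s) * M.weight (R ω)) ∂P) /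
        ∫ ω, M.weight (R ω) ∂P := by
  have hm : Measurable fun ω ↦ ((Z ω).1 s, R ω) := ((measurable_eval_state s).comp hZ).prodMk hR
  have h1 := M.continuous_vol
  have h2 := M.continuous_weight
  have h3 := M.continuous_μLi
  rw [potential, integral_map hm.aemeasurable, integral_map hm.aemeasurable]
  · rfl
  · exact (h2.comp continuous_snd).aestronglyMeasurable
  · refine Continuous.aestronglyMeasurable ?_
    change Continuous fun p : unitInterval × M.Radius ↦
      M.vol p.2 * M.qdot s + M.μLi p.1 * M.weight p.2
    fun_prop

/-- The weights have a constant sign, so that their average is nonzero. -/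
theorem abs_integral_weight (R : Ω → M.Radius) :
    |∫ ω, M.weight (R ω) ∂P| = ∫ ω, |M.weight (R ω)| ∂P := by
  rcases M.weight_pos_or_neg with h | h
  · simp_rw [fun ω ↦ abs_of_pos (h (R ω))]
    exact abs_of_nonneg (integral_nonneg fun ω ↦ (h (R ω)).le)
  · simp_rw [fun ω ↦ abs_of_neg (h (R ω))]
    rw [integral_neg]
    exact abs_of_nonpos (integral_nonpos fun ω ↦ (h (R ω)).le)

variable [IsProbabilityMeasure P]

theorem integrable_weight (hR : Measurable R) : Integrable (fun ω ↦ M.weight (R ω)) P := by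
  obtain ⟨c, C, -, -, h⟩ := M.exists_weight_bounds
  exact Integrable.of_bound (M.continuous_weight.measurable.comp hR).aestronglyMeasurable C
    (ae_of_all _ fun ω ↦ (h (R ω)).2.1)

theorem measurable_numerator (hZ : Measurable Z) (hR : Measurable R) (s : Set.Icc (0 : ℝ) T) :
    Measurable fun ω ↦ M.vol (R ω) * M.qdot s + M.μLi ((Z ω).1 s) * M.weight (R ω) :=
  ((M.continuous_vol.measurable.comp hR).mul_const _).add
    ((M.continuous_μLi.measurable.comp
      (measurable_subtype_coe.comp ((measurable_eval_state s).comp hZ))).mul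
      (M.continuous_weight.measurable.comp hR))

theorem integrable_numerator (hT : 0 < T) (hZ : Measurable Z) (hR : Measurable R)
    (s : Set.Icc (0 : ℝ) T) :
    Integrable (fun ω ↦ M.vol (R ω) * M.qdot s + M.μLi ((Z ω).1 s) * M.weight (R ω)) P := by
  obtain ⟨C, hC⟩ := M.exists_numerator_bound hT
  exact Integrable.of_bound (M.measurable_numerator hZ hR s).aestronglyMeasurable C
    (ae_of_all _ fun ω ↦ hC s _ _)

theorem exists_le_abs_integral_weight : ∃ c, 0 < c ∧ ∀ {Ω : Type} [MeasurableSpace Ω]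
    (P : Measure Ω) [IsProbabilityMeasure P] {R : Ω → M.Radius}, Measurable R →
    c ≤ |∫ ω, M.weight (R ω) ∂P| := by
  obtain ⟨c, C, hc, -, h⟩ := M.exists_weight_bounds
  refine ⟨c, hc, fun P _ R hR ↦ ?_⟩
  rw [abs_integral_weight]
  have := integral_mono (μ := P) (integrable_const c) (M.integrable_weight P hR).abs
    fun ω ↦ (h (R ω)).1
  simpa using this

theorem continuous_potential (hT : 0 < T) (hZ : Measurable Z) (hR : Measurable R) :
    Continuous fun s : Set.Icc (0 : ℝ) T ↦
      M.potential s (P.map fun ω ↦ ((Z ω).1 s, R ω)) := by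
  simp_rw [M.potential_map P hZ hR]
  refine Continuous.div_const ?_ _
  obtain ⟨C, hC⟩ := M.exists_numerator_bound hT
  refine continuous_of_dominated (bound := fun _ ↦ C)
    (fun s ↦ (M.measurable_numerator hZ hR s).aestronglyMeasurable)
    (fun s ↦ ae_of_all _ fun ω ↦ hC s _ _) (integrable_const C) (ae_of_all _ fun ω ↦ ?_)
  have h1 : Continuous fun s : Set.Icc (0 : ℝ) T ↦ M.qdot s :=
    continuousOn_iff_continuous_domRestrict.1 (M.continuousOn_qdot hT)
  have h2 := M.continuous_μLi
  have h3 : Continuous fun s ↦ ((Z ω).1 s : ℝ) := (realPath (Z ω).1).continuous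
  fun_prop

theorem exists_potential_bound (hT : 0 < T) : ∃ C, ∀ {Ω : Type} [MeasurableSpace Ω]
    (P : Measure Ω) [IsProbabilityMeasure P] {Z : Ω → StatePath T} {R : Ω → M.Radius},
    Measurable Z → Measurable R → ∀ s : Set.Icc (0 : ℝ) T,
    |M.potential s (P.map fun ω ↦ ((Z ω).1 s, R ω))| ≤ C := by
  obtain ⟨C, hC⟩ := M.exists_numerator_bound hT
  obtain ⟨c, hc, hw⟩ := M.exists_le_abs_integral_weight
  refine ⟨C / c, fun P _ Z R hZ hR s ↦ ?_⟩
  rw [M.potential_map P hZ hR, abs_div]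
  have h1 := norm_integral_le_of_norm_le_const (μ := P) (C := C)
    (f := fun ω ↦ M.vol (R ω) * M.qdot s + M.μLi ((Z ω).1 s) * M.weight (R ω))
    (ae_of_all _ fun ω ↦ hC s ((Z ω).1 s) (R ω))
  rw [probReal_univ, mul_one] at h1
  exact div_le_div₀ ((norm_nonneg _).trans h1) h1 hc (hw P hR)

/-- The potential is a Lipschitz function of the mole fractions, uniformly in the particles. -/
theorem exists_potential_lipschitz (hT : 0 < T) : ∃ L, 0 < L ∧ ∀ {Ω : Type} [MeasurableSpace Ω]
    (P : Measure Ω) [IsProbabilityMeasure P] {Z Z' : Ω → StatePath T} {R : Ω → M.Radius},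
    Measurable Z → Measurable Z' → Measurable R → ∀ (s : Set.Icc (0 : ℝ) T) (D : ℝ),
    (∀ ω, |((Z ω).1 s : ℝ) - (Z' ω).1 s| ≤ D) →
    |M.potential s (P.map fun ω ↦ ((Z ω).1 s, R ω)) -
      M.potential s (P.map fun ω ↦ ((Z' ω).1 s, R ω))| ≤ L * D := by
  obtain ⟨L, hL⟩ := M.μLi_lipschitz
  obtain ⟨c, hc, hw⟩ := M.exists_le_abs_integral_weight
  refine ⟨L + 1, by positivity, fun {Ω _} P _ Z Z' R hZ hZ' hR s D hD ↦ ?_⟩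
  have hw' := hc.trans_le (hw P hR)
  -- Both potentials have the same denominator. The numerators differ by at most `L D ∫ |weight|`,
  -- and the fixed sign makes this `L D |∫ weight|`, so the weights cancel.
  rw [M.potential_map P hZ hR, M.potential_map P hZ' hR, ← sub_div,
    ← integral_sub (M.integrable_numerator P hT hZ hR s) (M.integrable_numerator P hT hZ' hR s),
    abs_div, div_le_iff₀ hw', abs_integral_weight, ← integral_const_mul]
  refine (norm_integral_le_integral_norm _).trans (integral_mono_of_nonneg
    (ae_of_all _ fun ω ↦ norm_nonneg (_ : ℝ)) ((M.integrable_weight P hR).abs.const_mul _)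
    (ae_of_all _ fun ω ↦ ?_))
  have h1 : M.vol (R ω) * M.qdot s + M.μLi ((Z ω).1 s) * M.weight (R ω) -
      (M.vol (R ω) * M.qdot s + M.μLi ((Z' ω).1 s) * M.weight (R ω)) =
      (M.μLi ((Z ω).1 s) - M.μLi ((Z' ω).1 s)) * M.weight (R ω) := by ring
  beta_reduce
  rw [h1, Real.norm_eq_abs, abs_mul]
  refine mul_le_mul_of_nonneg_right ?_ (abs_nonneg _)
  have h2 := hL.dist_le_mul ((Z ω).1 s : ℝ) ((Z' ω).1 s)
  rw [Real.dist_eq, Real.dist_eq] at h2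
  have h3 := abs_nonneg (((Z ω).1 s : ℝ) - (Z' ω).1 s)
  have h4 : (L : ℝ) * |((Z ω).1 s : ℝ) - (Z' ω).1 s| ≤ L * D := by gcongr; exact hD ω
  linarith [hD ω]

end Potential

/-! ### The potential map and its fixed point. -/

/-- The surface potential generated by the responses to `Λ` of particles with radii and noises
distributed according to `m`. -/
def meanPotential (m : ProbabilityMeasure (M.Radius × PathSpace T ℝ)) (Λ : PathSpace T ℝ)
    (s : Set.Icc (0 : ℝ) T) : ℝ :=
  M.potential s ((m : Measure (M.Radius × PathSpace T ℝ)).map fun p ↦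
    ((M.response Λ p).1 s, p.1))

theorem measurable_response (Λ : PathSpace T ℝ) : Measurable (M.response Λ) :=
  (M.continuous_response Λ).measurable

/-- The potential at time `s` sees the responses at time `s`, which see `Λ` only up to `s`. The
constant does not depend on `m`; stability in `m` relies on this. -/
theorem exists_meanPotential_lipschitz (hT : 0 < T) : ∃ C, 0 < C ∧ ∀ m Λ Λ' s,
    |M.meanPotential m Λ s - M.meanPotential m Λ' s| ≤ C * primitive |Λ - Λ'| s := by
  obtain ⟨L, hL0, hL⟩ := M.exists_potential_lipschitz hT
  obtain ⟨K, hK0, hK⟩ := M.exists_response_lipschitz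
  refine ⟨L * K, by positivity, fun m Λ Λ' s ↦ ?_⟩
  rw [mul_assoc]
  exact hL _ (M.measurable_response Λ) (M.measurable_response Λ') measurable_fst s _
    fun p ↦ (hK Λ Λ' p s).1

theorem exists_selfPotential (hT : 0 < T) (m : ProbabilityMeasure (M.Radius × PathSpace T ℝ)) :
    ∃ Λ : PathSpace T ℝ, ∀ s, M.meanPotential m Λ s = Λ s := by
  obtain ⟨C, hC0, hC⟩ := M.exists_meanPotential_lipschitz hT
  obtain ⟨Λ, hΛ⟩ := exists_fixedPoint_of_volterra (fun Λ ↦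
    ⟨M.meanPotential m Λ, M.continuous_potential _ hT (M.measurable_response Λ) measurable_fst⟩)
    hC0 (hC m)
  exact ⟨Λ, fun s ↦ DFunLike.congr_fun hΛ s⟩

/-- The surface potential that is generated by the particles that respond to it. -/
def selfPotential (hT : 0 < T) (m : ProbabilityMeasure (M.Radius × PathSpace T ℝ)) :
    PathSpace T ℝ :=
  (M.exists_selfPotential hT m).choose

theorem meanPotential_selfPotential (hT : 0 < T)
    (m : ProbabilityMeasure (M.Radius × PathSpace T ℝ)) (s : Set.Icc (0 : ℝ) T) :
    M.meanPotential m (M.selfPotential hT m) s = M.selfPotential hT m s :=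
  (M.exists_selfPotential hT m).choose_spec s

/-- Two surface potentials that are approximately self-consistent are close to each other. -/
theorem exists_selfConsistency_stability (hT : 0 < T) : ∃ K, 0 < K ∧ ∀ m (Λ Λ' : PathSpace T ℝ),
    (∀ s, M.meanPotential m Λ s = Λ s) → ∫ s, |Λ s - Λ' s| ∂timeMeasure T ≤
      K * ∫ s, |M.meanPotential m Λ' s - Λ' s| ∂timeMeasure T := by
  obtain ⟨C, hC0, hC⟩ := M.exists_meanPotential_lipschitz hT
  refine ⟨2 * Real.exp (2 * C * T), by positivity, fun m Λ Λ' h ↦ ?_⟩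
  let e : PathSpace T ℝ := ⟨fun s ↦ |M.meanPotential m Λ' s - Λ' s|,
    ((M.continuous_potential _ hT (M.measurable_response Λ') measurable_fst).sub
      Λ'.continuous).abs⟩
  have he : 0 ≤ e := fun s ↦ abs_nonneg _
  set u : PathSpace T ℝ := |Λ - Λ'| with hu
  have hu0 : 0 ≤ u := abs_nonneg _
  have hle : ∀ s, u s ≤ (C • primitive u + e) s := fun s ↦ by
    change |Λ s - Λ' s| ≤ C * primitive u s + |M.meanPotential m Λ' s - Λ' s|
    rw [← h s]
    exact (abs_sub_le _ (M.meanPotential m Λ' s) _).trans (add_le_add (hC m Λ Λ' s) le_rfl)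
  -- Grönwall is applied to the primitive of `u` rather than to `u`, so that the defect enters only
  -- through its integral.
  have hd : ∀ t, primitive u t ≤ ∫ s, e s ∂timeMeasure T + C * primitive (primitive u) t :=
    fun t ↦ by
      have h1 := primitive_mono (t := t) fun s _ ↦ hle s
      have h2 : primitive (C • primitive u + e) t =
          C * primitive (primitive u) t + primitive e t := by
        rw [← sub_neg_eq_add, primitive_sub, primitive_smul, ← neg_one_smul ℝ e, primitive_smul]
        simp
      rw [h2] at h1
      linarith [primitive_le_integral he t]
  have hI : 0 ≤ ∫ s, e s ∂timeMeasure T := integral_nonneg he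
  have := gronwall_path (t₁ := ⟨T, hT.le, le_rfl⟩) hC0 (fun t _ ↦ hd t) hI ⟨T, hT.le, le_rfl⟩ le_rfl
  have huniv : Set.Iic (⟨T, hT.le, le_rfl⟩ : Set.Icc (0 : ℝ) T) = Set.univ :=
    Set.eq_univ_of_forall fun s ↦ s.2.2
  rw [primitive_apply, huniv, setIntegral_univ] at this
  exact this

/-- The second potential has zero defect, so the `L¹` distance vanishes. The Volterra bound on
`meanPotential` then upgrades this to equality at every time. -/
theorem eq_selfPotential (hT : 0 < T) {m : ProbabilityMeasure (M.Radius × PathSpace T ℝ)}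
    {Λ : PathSpace T ℝ} (h : ∀ s, M.meanPotential m Λ s = Λ s) : Λ = M.selfPotential hT m := by
  obtain ⟨K, -, hK⟩ := M.exists_selfConsistency_stability hT
  obtain ⟨C, hC0, hC⟩ := M.exists_meanPotential_lipschitz hT
  have h0 := hK m Λ (M.selfPotential hT m) h
  simp_rw [meanPotential_selfPotential, sub_self, abs_zero, integral_zero, mul_zero] at h0
  ext s
  have h1 := hC m Λ (M.selfPotential hT m) s
  have h2 := primitive_le_integral (v := |Λ - M.selfPotential hT m|) (abs_nonneg (_ : PathSpace T ℝ)) s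
  have h3 := mul_le_mul_of_nonneg_left (h2.trans h0) hC0.le
  rw [h, meanPotential_selfPotential] at h1
  rw [← sub_eq_zero, ← abs_nonpos_iff]
  linarith

/-- For fixed `Λ`, numerator and denominator are integrals of bounded continuous functions of
(radius, noise), since the response is continuous; the limiting denominator is nonzero. -/
theorem tendsto_meanPotential (hT : 0 < T) {ι : Type*} {l : Filter ι}
    {ms : ι → ProbabilityMeasure (M.Radius × PathSpace T ℝ)}
    {m : ProbabilityMeasure (M.Radius × PathSpace T ℝ)} (h : Tendsto ms l (𝓝 m))
    (Λ : PathSpace T ℝ) (s : Set.Icc (0 : ℝ) T) :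
    Tendsto (fun i ↦ M.meanPotential (ms i) Λ s) l (𝓝 (M.meanPotential m Λ s)) := by
  simp only [meanPotential, M.potential_map _ (M.measurable_response Λ) measurable_fst]
  obtain ⟨C, hC⟩ := M.exists_numerator_bound hT
  obtain ⟨_, C', -, -, hC'⟩ := M.exists_weight_bounds
  obtain ⟨c, hc, hw⟩ := M.exists_le_abs_integral_weight
  have h1 := M.continuous_vol
  have h2 := M.continuous_weight
  have h3 := M.continuous_μLi
  have h4 : Continuous fun p ↦ ((M.response Λ p).1 s : ℝ) :=
    continuous_subtype_val.comp ((ContinuousEvalConst.continuous_eval_const s).comp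
      (continuous_fst.comp (M.continuous_response Λ)))
  rw [ProbabilityMeasure.tendsto_iff_forall_integral_tendsto] at h
  refine Tendsto.div ?_ ?_ ?_
  · exact h (BoundedContinuousFunction.ofNormedAddCommGroup (fun p : M.Radius × PathSpace T ℝ ↦
      M.vol p.1 * M.qdot s + M.μLi ((M.response Λ p).1 s) * M.weight p.1) (by fun_prop) C
      fun p ↦ hC s _ _)
  · exact h (BoundedContinuousFunction.ofNormedAddCommGroup (fun p : M.Radius × PathSpace T ℝ ↦
      M.weight p.1) (by fun_prop) C' fun p ↦ (hC' p.1).2.1)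
  · exact abs_pos.1 (hc.trans_le (hw _ measurable_fst))

/-- The self-consistent surface potential depends continuously on the law of the particles. -/
theorem tendsto_selfPotential (hT : 0 < T) {ι : Type*} {l : Filter ι} [l.IsCountablyGenerated]
    {ms : ι → ProbabilityMeasure (M.Radius × PathSpace T ℝ)}
    {m : ProbabilityMeasure (M.Radius × PathSpace T ℝ)} (h : Tendsto ms l (𝓝 m)) :
    Tendsto (fun i ↦ ∫ s, |M.selfPotential hT (ms i) s - M.selfPotential hT m s| ∂timeMeasure T)
      l (𝓝 0) := by
  obtain ⟨K, -, hK⟩ := M.exists_selfConsistency_stability hT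
  obtain ⟨C, hC⟩ := M.exists_potential_bound hT
  -- The limit potential is treated as an approximate fixed point for `ms i`. Its defect involves a
  -- potential that does not vary with `i`, so it tends to 0 pointwise in time, and boundedly.
  refine squeeze_zero (fun i ↦ integral_nonneg fun _ ↦ abs_nonneg _)
    (fun i ↦ hK (ms i) _ (M.selfPotential hT m) (M.meanPotential_selfPotential hT (ms i))) ?_
  suffices hlim : Tendsto (fun i ↦ ∫ s, |M.meanPotential (ms i) (M.selfPotential hT m) s -
      M.selfPotential hT m s| ∂timeMeasure T) l (𝓝 (∫ _, (0 : ℝ) ∂timeMeasure T)) by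
    simpa using hlim.const_mul K
  have hcont : ∀ i, Continuous (M.meanPotential (ms i) (M.selfPotential hT m)) := fun i ↦
    M.continuous_potential _ hT (M.measurable_response _) measurable_fst
  refine tendsto_integral_filter_of_dominated_convergence (fun _ ↦ C + C)
    (Eventually.of_forall fun i ↦
      ((hcont i).sub (M.selfPotential hT m).continuous).abs.aestronglyMeasurable)
    (Eventually.of_forall fun i ↦ ae_of_all _ fun s ↦ ?_) (integrable_const _)
    (ae_of_all _ fun s ↦ ?_)
  · rw [Real.norm_eq_abs, abs_abs, ← M.meanPotential_selfPotential]
    exact (abs_sub _ _).trans (add_le_add (hC _ (M.measurable_response _) measurable_fst s)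
      (hC _ (M.measurable_response _) measurable_fst s))
  · have := ((M.tendsto_meanPotential hT h (M.selfPotential hT m) s).sub_const
      (M.selfPotential hT m s)).abs
    rwa [M.meanPotential_selfPotential, sub_self, abs_zero] at this

/-- The response to the self-consistent surface potential. -/
def selfResponse (hT : 0 < T) (m : ProbabilityMeasure (M.Radius × PathSpace T ℝ))
    (p : M.Radius × PathSpace T ℝ) : StatePath T :=
  M.response (M.selfPotential hT m) p

theorem measurable_selfResponse (hT : 0 < T)
    (m : ProbabilityMeasure (M.Radius × PathSpace T ℝ)) : Measurable (M.selfResponse hT m) :=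
  M.measurable_response _

/-- The convergence is uniform over all radii and noises because the Lipschitz constant of the
response in `Λ` does not depend on the particle. -/
theorem tendsto_selfResponse (hT : 0 < T) {ι : Type*} {l : Filter ι} [l.IsCountablyGenerated]
    {ms : ι → ProbabilityMeasure (M.Radius × PathSpace T ℝ)}
    {m : ProbabilityMeasure (M.Radius × PathSpace T ℝ)} (h : Tendsto ms l (𝓝 m)) :
    TendstoUniformly (fun i ↦ M.selfResponse hT (ms i)) (M.selfResponse hT m) l := by
  obtain ⟨K, hK0, hK⟩ := M.exists_response_dist_le
  have h1 := (M.tendsto_selfPotential hT h).const_mul K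
  rw [mul_zero] at h1
  refine Metric.tendstoUniformly_iff.2 fun ε hε ↦ (h1.eventually (gt_mem_nhds hε)).mono
    fun i hi p ↦ ?_
  rw [dist_comm]
  exact (hK _ _ p).trans_lt hi

end Model


/-! ### A law of large numbers for empirical measures -/

section LawOfLargeNumbers

variable {Ω : Type*} [MeasurableSpace Ω] {P : Measure Ω}

/-- Weak convergence can be checked on countably many test functions; hence almost sure
convergence for each test function implies almost sure weak convergence. -/
theorem ae_tendsto_of_forall_ae_tendsto_integral {E : Type*} [TopologicalSpace E]
    [SecondCountableTopology E] [TopologicalSpace.PseudoMetrizableSpace E] [MeasurableSpace E]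
    [OpensMeasurableSpace E] {μs : ℕ → Ω → ProbabilityMeasure E} {μ : ProbabilityMeasure E}
    (h : ∀ f : BoundedContinuousFunction E ℝ, ∀ᵐ ω ∂P,
      Tendsto (fun n ↦ ∫ x, f x ∂(μs n ω : Measure E)) atTop (𝓝 (∫ x, f x ∂(μ : Measure E)))) :
    ∀ᵐ ω ∂P, Tendsto (fun n ↦ μs n ω) atTop (𝓝 μ) := by
  have hnn : ∀ f : BoundedContinuousFunction E ℝ≥0, ∀ᵐ ω ∂P,
      Tendsto (fun n ↦ ∫⁻ x, f x ∂(μs n ω : Measure E)) atTop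
        (𝓝 (∫⁻ x, f x ∂(μ : Measure E))) := fun f ↦ by
    have hcont : Continuous fun x ↦ ((f x : ℝ≥0) : ℝ) := NNReal.continuous_coe.comp f.continuous
    let g : BoundedContinuousFunction E ℝ := ⟨⟨fun x ↦ ((f x : ℝ≥0) : ℝ), hcont⟩, f.map_bounded'⟩
    have hg : ∀ ν : ProbabilityMeasure E,
        ∫⁻ x, f x ∂(ν : Measure E) = ENNReal.ofReal (∫ x, g x ∂(ν : Measure E)) := fun ν ↦
      lintegral_coe_eq_integral _ (g.integrable (ν : Measure E))
    filter_upwards [h g] with ω hω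
    simp_rw [hg]
    exact (ENNReal.continuous_ofReal.tendsto _).comp hω
  -- A closed set is a decreasing limit of complements of finite unions of basic open sets.
  -- Continuous approximations of the indicators of these complements are countably many, and they
  -- suffice for the limsup bound on closed sets.
  let B := TopologicalSpace.countableBasis E
  have hBo : ∀ s : Finset B, IsOpen (⋃ b ∈ s, (b : Set E)) := fun s ↦
    isOpen_biUnion fun b _ ↦ TopologicalSpace.isOpen_of_mem_countableBasis b.2
  have : Countable B := (TopologicalSpace.countable_countableBasis E).to_subtype
  have hall : ∀ᵐ ω ∂P, ∀ (s : Finset B) (j : ℕ), Tendsto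
      (fun n ↦ ∫⁻ x, (hBo s).isClosed_compl.apprSeq j x ∂(μs n ω : Measure E)) atTop
        (𝓝 (∫⁻ x, (hBo s).isClosed_compl.apprSeq j x ∂(μ : Measure E))) :=
    ae_all_iff.2 fun s ↦ ae_all_iff.2 fun j ↦ hnn _
  filter_upwards [hall] with ω hω
  refine tendsto_of_forall_isClosed_limsup_le' fun F hF ↦ le_of_forall_gt fun c hc ↦ ?_
  obtain ⟨s, hs, hsF⟩ : ∃ s : Finset B, (μ : Measure E) (⋃ b ∈ s, (b : Set E))ᶜ < c ∧
      F ⊆ (⋃ b ∈ s, (b : Set E))ᶜ := by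
    let S := {b : B // (b : Set E) ⊆ Fᶜ}
    let A : Finset S → Set E := fun s ↦ (⋃ b ∈ s, (b.1 : Set E))ᶜ
    have hA : Antitone A := fun s t hst ↦
      Set.compl_subset_compl.2 (Set.biUnion_subset_biUnion_left hst)
    have hFA : ∀ s, F ⊆ A s := fun s ↦
      Set.subset_compl_comm.1 (Set.iUnion₂_subset fun b _ ↦ b.2)
    have hmA : ∀ s, MeasurableSet (A s) := fun s ↦
      (isOpen_biUnion fun b _ ↦
        TopologicalSpace.isOpen_of_mem_countableBasis b.1.2).measurableSet.compl
    have hinter : ⋂ s, A s = F := by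
      refine Set.Subset.antisymm (fun x hx ↦ ?_) (Set.subset_iInter hFA)
      by_contra hxF
      obtain ⟨b, hb, hxb, hbF⟩ := (TopologicalSpace.isBasis_countableBasis E).mem_nhds_iff.1
        (hF.isOpen_compl.mem_nhds hxF)
      have := Set.mem_iInter.1 hx {⟨⟨b, hb⟩, hbF⟩}
      exact this (by simpa using hxb)
    have hμ := Directed.measure_iInter (μ := (μ : Measure E)) (fun s ↦ (hmA s).nullMeasurableSet)
      hA.directed_ge ⟨∅, measure_ne_top _ _⟩
    rw [hinter] at hμ
    rw [hμ, iInf_lt_iff] at hc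
    obtain ⟨s, hs⟩ := hc
    have hsA : (⋃ b ∈ s.map (Function.Embedding.subtype _), (b : Set E))ᶜ = A s := by
      ext x
      simp only [A, Set.mem_compl_iff, Set.mem_iUnion, Finset.mem_map,
        Function.Embedding.subtype_apply, exists_prop]
      exact not_congr ⟨fun ⟨_, ⟨a, ha, hab⟩, hx⟩ ↦ ⟨a, ha, hab ▸ hx⟩,
        fun ⟨a, ha, hx⟩ ↦ ⟨a.1, ⟨a, ha, rfl⟩, hx⟩⟩
    exact ⟨s.map (Function.Embedding.subtype _), hsA ▸ hs, hsA ▸ hFA s⟩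
  obtain ⟨j, hj⟩ := ((HasOuterApproxClosed.tendsto_lintegral_apprSeq (hBo s).isClosed_compl
    (μ : Measure E)).eventually (gt_mem_nhds hs)).exists
  obtain ⟨c', hc', hc'c⟩ := exists_between hj
  refine (limsup_le_of_le (by isBoundedDefault) (((hω s j).eventually (gt_mem_nhds hc')).mono
    fun n hn ↦ ?_)).trans_lt hc'c
  exact (measure_mono hsF).trans ((HasOuterApproxClosed.measure_le_lintegral _ _ j).trans hn.le)

variable [IsProbabilityMeasure P]

/-- One-sided law of large numbers for uniformly bounded, centered, independent variables. -/
theorem ae_eventually_sum_lt {X : ℕ → Ω → ℝ} (hX : ∀ i, Measurable (X i)) (hind : iIndepFun X P)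
    {C : ℝ} (hC : 0 < C) (hb : ∀ i ω, |X i ω| ≤ C) (h0 : ∀ i, ∫ ω, X i ω ∂P = 0) {ε : ℝ}
    (hε : 0 < ε) : ∀ᵐ ω ∂P, ∀ᶠ n : ℕ in atTop, ∑ i ∈ Finset.range n, X i ω < n * ε := by
  set c : ℝ≥0 := (‖C - -C‖₊ / 2) ^ 2 with hc
  have hc0 : 0 < (c : ℝ) := by
    have : 0 < ‖C - -C‖ := norm_pos_iff.2 (by linarith)
    simp only [hc, NNReal.coe_pow, NNReal.coe_div, coe_nnnorm]
    positivity
  have hsub : ∀ i, HasSubgaussianMGF (X i) c P := fun i ↦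
    hasSubgaussianMGF_of_mem_Icc_of_integral_eq_zero (hX i).aemeasurable
      (ae_of_all _ fun ω ↦ abs_le.1 (hb i ω)) (h0 i)
  -- Hoeffding's bound is exponentially small in `n`, hence summable, and Borel–Cantelli applies.
  -- Identical distribution is not needed; with deterministic radii it would fail.
  have hP : ∀ n : ℕ, P.real {ω | n * ε ≤ ∑ i ∈ Finset.range n, X i ω} ≤
      Real.exp (n * (-(ε ^ 2 / (2 * c)))) := fun n ↦ by
    refine (HasSubgaussianMGF.measure_sum_range_ge_le_of_iIndepFun hind (fun i _ ↦ hsub i)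
      (by positivity)).trans (Real.exp_le_exp.2 ?_)
    rcases Nat.eq_zero_or_pos n with rfl | hn
    · simp
    · have : (0 : ℝ) < n := by exact_mod_cast hn
      apply le_of_eq
      field_simp
  have hsum : Summable fun n : ℕ ↦ Real.exp (n * (-(ε ^ 2 / (2 * c)))) :=
    Real.summable_exp_nat_mul_iff.2 (by
      have : 0 < ε ^ 2 / (2 * c) := by positivity
      linarith)
  have hfin : ∑' n : ℕ, P {ω | n * ε ≤ ∑ i ∈ Finset.range n, X i ω} ≠ ∞ := by
    refine ne_top_of_le_ne_top hsum.tsum_ofReal_ne_top (ENNReal.tsum_le_tsum fun n ↦ ?_)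
    rw [← ofReal_measureReal]
    exact ENNReal.ofReal_le_ofReal (hP n)
  filter_upwards [ae_eventually_notMem hfin] with ω hω
  exact hω.mono fun n hn ↦ not_le.1 hn

/-- The strong law of large numbers for uniformly bounded, centered, independent variables. -/
theorem ae_tendsto_average_zero {X : ℕ → Ω → ℝ} (hX : ∀ i, Measurable (X i))
    (hind : iIndepFun X P) {C : ℝ} (hC : 0 < C) (hb : ∀ i ω, |X i ω| ≤ C)
    (h0 : ∀ i, ∫ ω, X i ω ∂P = 0) :
    ∀ᵐ ω ∂P, Tendsto (fun n : ℕ ↦ (n : ℝ)⁻¹ * ∑ i ∈ Finset.range n, X i ω) atTop (𝓝 0) := by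
  have hneg : iIndepFun (fun i ω ↦ -X i ω) P := hind.comp (fun _ x ↦ -x) fun _ ↦ measurable_neg
  have h1 : ∀ k : ℕ, ∀ᵐ ω ∂P, ∀ᶠ n : ℕ in atTop,
      ∑ i ∈ Finset.range n, X i ω < n * (1 / ((k : ℝ) + 1)) := fun k ↦
    ae_eventually_sum_lt hX hind hC hb h0 (by positivity)
  have h2 : ∀ k : ℕ, ∀ᵐ ω ∂P, ∀ᶠ n : ℕ in atTop,
      ∑ i ∈ Finset.range n, -X i ω < n * (1 / ((k : ℝ) + 1)) := fun k ↦
    ae_eventually_sum_lt (fun i ↦ (hX i).neg) hneg hC (fun i ω ↦ by rw [Pi.neg_apply, abs_neg]; exact hb i ω)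
      (fun i ↦ by simp_rw [Pi.neg_apply]; rw [integral_neg, h0, neg_zero]) (by positivity)
  filter_upwards [ae_all_iff.2 h1, ae_all_iff.2 h2] with ω hω1 hω2
  rw [Metric.tendsto_nhds]
  intro ε hε
  obtain ⟨k, hk⟩ := exists_nat_one_div_lt hε
  filter_upwards [hω1 k, hω2 k, eventually_gt_atTop 0] with n hn1 hn2 hn0
  have hn : (0 : ℝ) < n := by exact_mod_cast hn0
  rw [Finset.sum_neg_distrib] at hn2
  rw [Real.dist_eq, sub_zero, abs_mul, abs_of_pos (inv_pos.2 hn), inv_mul_lt_iff₀ hn]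
  exact (abs_lt.2 ⟨by linarith, hn1⟩).trans (mul_lt_mul_of_pos_left hk hn)

end LawOfLargeNumbers

/-- Pushforwards under uniformly converging maps of weakly converging measures converge. -/
theorem tendsto_of_tendstoUniformly {E F : Type*} [TopologicalSpace E] [MeasurableSpace E]
    [OpensMeasurableSpace E] [PseudoMetricSpace F] [MeasurableSpace F] [BorelSpace F]
    [SecondCountableTopology F]
    {ms : ℕ → ProbabilityMeasure E} {m : ProbabilityMeasure E} (hm : Tendsto ms atTop (𝓝 m))
    {φs : ℕ → E → F} {φ : E → F} (hφs : ∀ n, Measurable (φs n)) (hφ : Continuous φ)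
    (h : TendstoUniformly φs φ atTop) {νs : ℕ → ProbabilityMeasure F} {ν : ProbabilityMeasure F}
    (hνs : ∀ n, (νs n : Measure F) = (ms n : Measure E).map (φs n))
    (hν : (ν : Measure F) = (m : Measure E).map φ) : Tendsto νs atTop (𝓝 ν) := by
  -- For a bounded Lipschitz `f`, replacing `φs n` by `φ` costs at most `L` times their uniform
  -- distance, whatever the measure. What remains is weak convergence tested on `f ∘ φ`.
  rw [tendsto_iff_forall_lipschitz_integral_tendsto]
  rintro f ⟨C, hC⟩ ⟨L, hL⟩
  have hfc := hL.continuous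
  have hbound : ∀ (μ : Measure E) [IsProbabilityMeasure μ] {ψ : E → F}, Measurable ψ →
      Integrable (fun x ↦ f (ψ x)) μ := fun μ _ ψ hψ ↦ by
    obtain ⟨x₀⟩ : Nonempty E := nonempty_of_isProbabilityMeasure μ
    refine Integrable.of_bound (hfc.measurable.comp hψ).aestronglyMeasurable
      (‖f (ψ x₀)‖ + C) (ae_of_all _ fun x ↦ ?_)
    have h1 := norm_sub_norm_le (f (ψ x)) (f (ψ x₀))
    have h2 := hC (ψ x) (ψ x₀)
    rw [dist_eq_norm] at h2
    linarith
  have hint : ∀ n, ∫ y, f y ∂(νs n : Measure F) = ∫ x, f (φs n x) ∂(ms n : Measure E) := fun n ↦ by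
    rw [hνs, integral_map (hφs n).aemeasurable hfc.aestronglyMeasurable]
  have hint' : ∫ y, f y ∂(ν : Measure F) = ∫ x, f (φ x) ∂(m : Measure E) := by
    rw [hν, integral_map hφ.measurable.aemeasurable hfc.aestronglyMeasurable]
  simp_rw [hint, hint']
  have h1 : Tendsto (fun n ↦ ∫ x, f (φ x) ∂(ms n : Measure E)) atTop
      (𝓝 (∫ x, f (φ x) ∂(m : Measure E))) :=
    ProbabilityMeasure.tendsto_iff_forall_integral_tendsto.1 hm
      ⟨⟨fun x ↦ f (φ x), hfc.comp hφ⟩, C, fun x y ↦ hC _ _⟩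
  have h2 : Tendsto (fun n ↦ ∫ x, f (φs n x) ∂(ms n : Measure E) -
      ∫ x, f (φ x) ∂(ms n : Measure E)) atTop (𝓝 0) := by
    rw [Metric.tendsto_nhds]
    intro ε hε
    have hδ : 0 < ε / 2 / (L + 1) := by positivity
    filter_upwards [Metric.tendstoUniformly_iff.1 h _ hδ] with n hn
    rw [dist_zero_right, ← integral_sub (hbound _ (hφs n)) (hbound _ hφ.measurable)]
    have h3 := norm_integral_le_of_norm_le_const (μ := (ms n : Measure E)) (C := ε / 2)
      (f := fun x ↦ f (φs n x) - f (φ x)) (ae_of_all _ fun x ↦ by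
        have h4 := hL.dist_le_mul (φs n x) (φ x)
        have h5 := hn x
        rw [dist_comm] at h5
        have h6 : (L : ℝ) * dist (φs n x) (φ x) ≤ (L + 1) * (ε / 2 / (L + 1)) := by
          gcongr
          linarith
        have h7 : (L + 1 : ℝ) * (ε / 2 / (L + 1)) = ε / 2 := by field_simp
        rw [← dist_eq_norm]
        linarith)
    rw [probReal_univ, mul_one] at h3
    linarith
  simpa using h2.add h1

/-! ### Brownian paths -/

/-- A time as a nonnegative real number. -/
def nnTime {T : ℝ} (t : Set.Icc (0 : ℝ) T) : ℝ≥0 := ⟨t, t.2.1⟩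

namespace IsBrownianPath

variable {T : ℝ} {Ω : Type*} [MeasurableSpace Ω] {P : Measure Ω} {W : Ω → PathSpace T ℝ}

theorem hasLaw_eval (h : IsBrownianPath W P) (t : Set.Icc (0 : ℝ) T) :
    HasLaw (fun ω ↦ W ω t) (gaussianReal 0 (nnTime t)) P := by
  have hJ : ∀ s ∈ ({nnTime t} : Finset ℝ≥0), (s : ℝ) ≤ T := fun s hs ↦ by
    rw [Finset.mem_singleton.1 hs]; exact t.2.2
  exact (BrownianReal.measurePreserving_eval_projectiveFamily
    (I := {nnTime t}) ⟨nnTime t, Finset.mem_singleton_self _⟩).hasLaw.comp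
      (h.hasLaw {nnTime t} hJ)

theorem ae_initialValue (h : IsBrownianPath W P) : ∀ᵐ ω ∂P, initialValue (W ω) = 0 := by
  by_cases hT : 0 ≤ T
  · let t : Set.Icc (0 : ℝ) T := ⟨0, le_rfl, hT⟩
    have h0 : nnTime t = 0 := rfl
    have := h.hasLaw_eval t
    rw [h0, gaussianReal_zero_var] at this
    filter_upwards [this.ae_eq_of_dirac] with ω hω
    rw [initialValue_eq (t := t) _ rfl]
    exact hω
  · exact ae_of_all _ fun ω ↦ by rw [initialValue, dif_neg hT]

/-- The right-hand side does not involve `W`. -/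
theorem map_restrict (h : IsBrownianPath W P) (D : Set (Set.Icc (0 : ℝ) T)) (I : Finset D) :
    (P.map fun ω (d : D) ↦ W ω d).map I.restrict =
      (BrownianReal.projectiveFamily (I.image fun d ↦ nnTime d.1)).map
        fun x (d : I) ↦ x ⟨nnTime d.1.1, Finset.mem_image_of_mem _ d.2⟩ := by
  have hJ : ∀ t ∈ I.image fun d ↦ nnTime d.1, (t : ℝ) ≤ T := fun t ht ↦ by
    obtain ⟨d, -, rfl⟩ := Finset.mem_image.1 ht
    exact d.1.2.2
  have hl := h.hasLaw _ hJ
  have hm : Measurable fun ω (d : D) ↦ W ω d := measurable_pi_lambda _ fun d ↦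
    (ContinuousEvalConst.continuous_eval_const (d : Set.Icc (0 : ℝ) T)).measurable.comp h.measurable
  rw [← hl.map_eq, AEMeasurable.map_map_of_aemeasurable _ hl.aemeasurable, Measure.map_map _ hm]
  · rfl
  · exact measurable_pi_lambda _ fun d ↦ measurable_pi_apply _
  · exact (measurable_pi_lambda _ fun d ↦ measurable_pi_apply _).aemeasurable

/-- All Brownian paths have the same law. -/
theorem map_eq_map (h : IsBrownianPath W P) {Ω' : Type*} [MeasurableSpace Ω'] {P' : Measure Ω'}
    {W' : Ω' → PathSpace T ℝ} (h' : IsBrownianPath W' P') : P.map W = P'.map W' := by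
  -- Restriction to a countable dense set of times is continuous and injective, hence a measurable
  -- embedding. The law is thus determined by that of the restriction, a projective limit of the
  -- finite-dimensional laws.
  obtain ⟨D, hDc, hDd⟩ := TopologicalSpace.exists_countable_dense (Set.Icc (0 : ℝ) T)
  have : Countable D := hDc.to_subtype
  let ι : PathSpace T ℝ → D → ℝ := fun w d ↦ w d
  have hι : Continuous ι := continuous_pi fun d ↦ ContinuousEvalConst.continuous_eval_const _
  have hinj : Function.Injective ι := fun w w' hw ↦
    DFunLike.coe_injective (Continuous.ext_on hDd w.continuous w'.continuous fun d hd ↦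
      congrFun hw ⟨d, hd⟩)
  refine (hι.measurableEmbedding hinj).map_injective ?_
  rw [Measure.map_map hι.measurable h.measurable, Measure.map_map hι.measurable h'.measurable]
  let Q : ∀ I : Finset D, Measure (I → ℝ) := fun I ↦
    (BrownianReal.projectiveFamily (I.image fun d ↦ nnTime d.1)).map
      fun x d ↦ x ⟨nnTime d.1.1, Finset.mem_image_of_mem _ d.2⟩
  have : ∀ I, IsFiniteMeasure (Q I) := fun I ↦ inferInstanceAs (IsFiniteMeasure (Measure.map _ _))
  have h1 : IsProjectiveLimit (P.map (ι ∘ W)) Q := h.map_restrict D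
  have h2 : IsProjectiveLimit (P'.map (ι ∘ W')) Q := h'.map_restrict D
  exact h1.unique h2

end IsBrownianPath


/-! ### Almost sure convergence of the inputs. -/

/-- Empirical measures of independent, identically distributed variables paired with a
deterministic sequence whose empirical measures converge. -/
theorem ae_tendsto_empiricalMeasure_prod {A B Ω : Type*} [TopologicalSpace A] [TopologicalSpace B]
    [SecondCountableTopology A] [SecondCountableTopology B]
    [TopologicalSpace.MetrizableSpace A] [TopologicalSpace.MetrizableSpace B]
    [MeasurableSpace A] [MeasurableSpace B] [BorelSpace A] [BorelSpace B]
    [MeasurableSpace Ω] {P : Measure Ω} [IsProbabilityMeasure P] {W : ℕ → Ω → B}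
    (hW : ∀ i, Measurable (W i)) (hind : iIndepFun W P) {ν : ProbabilityMeasure B}
    (hν : ∀ i, P.map (W i) = ν) {r : ℕ → A} {lam : ProbabilityMeasure A}
    (hr : Tendsto (fun n : ℕ ↦ empiricalMeasure fun i : Fin (n + 1) ↦ r i) atTop (𝓝 lam)) :
    ∀ᵐ ω ∂P, Tendsto (fun n : ℕ ↦ empiricalMeasure fun i : Fin (n + 1) ↦ (r i, W i ω)) atTop
      (𝓝 (lam.prod ν)) := by
  refine ae_tendsto_of_forall_ae_tendsto_integral fun f ↦ ?_
  -- Averaging out the noise splits the empirical integral into centered independent terms `f (r i,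
  -- W i) - g (r i)`, handled by the law of large numbers, and an average of the bounded continuous
  -- `g`, handled by the convergence of the radii.
  let g : A → ℝ := fun a ↦ ∫ b, f (a, b) ∂(ν : Measure B)
  have hfa : ∀ a, Integrable (fun b ↦ f (a, b)) (ν : Measure B) := fun a ↦
    Integrable.of_bound (f.continuous.comp (by fun_prop)).aestronglyMeasurable ‖f‖
      (ae_of_all _ fun b ↦ f.norm_coe_le_norm _)
  have hgb : ∀ a, ‖g a‖ ≤ ‖f‖ := fun a ↦ by
    simpa using norm_integral_le_of_norm_le_const (μ := (ν : Measure B))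
      (ae_of_all _ fun b ↦ f.norm_coe_le_norm (a, b))
  have hg : Continuous g := continuous_of_dominated
    (fun a ↦ (hfa a).aestronglyMeasurable) (fun a ↦ ae_of_all _ fun b ↦ f.norm_coe_le_norm (a, b))
    (integrable_const ‖f‖) (ae_of_all _ fun b ↦ f.continuous.comp (by fun_prop))
  have hφ : ∀ i, Measurable fun b ↦ f (r i, b) - g (r i) := fun i ↦
    ((f.continuous.comp (by fun_prop)).measurable).sub_const _
  have hlln := ae_tendsto_average_zero (P := P) (X := fun i ω ↦ f (r i, W i ω) - g (r i))
    (fun i ↦ (hφ i).comp (hW i)) (hind.comp (fun i b ↦ f (r i, b) - g (r i)) hφ)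
    (C := ‖f‖ + ‖f‖ + 1) (by positivity)
    (fun i ω ↦ by
      have h1 := norm_sub_le (f (r i, W i ω)) (g (r i))
      have h2 := f.norm_coe_le_norm (r i, W i ω)
      have h3 := hgb (r i)
      rw [← Real.norm_eq_abs]
      linarith)
    (fun i ↦ by
      have h1 : ∫ ω, f (r i, W i ω) - g (r i) ∂P = ∫ b, f (r i, b) - g (r i) ∂(P.map (W i)) :=
        (integral_map (hW i).aemeasurable (hφ i).aestronglyMeasurable).symm
      rw [h1, hν, integral_sub (hfa _) (integrable_const _)]
      simp [g])
  have hlim : Tendsto (fun n : ℕ ↦ ∫ a, g a ∂(empiricalMeasure fun i : Fin (n + 1) ↦ r i : Measure A))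
      atTop (𝓝 (∫ a, g a ∂(lam : Measure A))) :=
    ProbabilityMeasure.tendsto_iff_forall_integral_tendsto.1 hr
      (BoundedContinuousFunction.ofNormedAddCommGroup g hg ‖f‖ hgb)
  have hfub : ∫ x, f x ∂(lam.prod ν : Measure (A × B)) = ∫ a, g a ∂(lam : Measure A) :=
    integral_prod _ (f.integrable _)
  filter_upwards [hlln] with ω hω
  rw [hfub]
  have h1 := ((tendsto_add_atTop_iff_nat 1).2 hω).add hlim
  rw [zero_add] at h1
  refine h1.congr fun n ↦ ?_
  rw [integral_empiricalMeasure, integral_empiricalMeasure,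
    Fin.sum_univ_eq_sum_range (fun i ↦ g (r i)), Fin.sum_univ_eq_sum_range (fun i ↦ f (r i, W i ω)),
    ← mul_add, ← Finset.sum_add_distrib]
  simp

namespace Model

variable {T : ℝ} (M : Model T)

/-! ### The particle system -/

section Particles

variable {n : ℕ} [NeZero n]

theorem potential_empiricalMeasure (t : ℝ) (r : Fin n → M.Radius) (x : Fin n → unitInterval) :
    M.potential t (empiricalMeasure fun j ↦ (x j, r j)) =
      M.particlePotential t r fun j ↦ (x j : ℝ) := by
  have hn : (n : ℝ)⁻¹ ≠ 0 := inv_ne_zero (by exact_mod_cast NeZero.ne n)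
  rw [potential, integral_empiricalMeasure, integral_empiricalMeasure, mul_div_mul_left _ _ hn]
  rfl

theorem meanPotential_empiricalMeasure (r : Fin n → M.Radius) (w : Fin n → PathSpace T ℝ)
    (Λ : PathSpace T ℝ) (s : Set.Icc (0 : ℝ) T) :
    M.meanPotential (empiricalMeasure fun j ↦ (r j, w j)) Λ s =
      M.particlePotential s r fun j ↦ ((M.response Λ (r j, w j)).1 s : ℝ) := by
  have hm : Measurable fun p ↦ ((M.response Λ p).1 s, p.1) :=
    ((measurable_eval_state s).comp (M.measurable_response Λ)).prodMk measurable_fst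
  rw [meanPotential, map_empiricalMeasure _ hm]
  exact M.potential_empiricalMeasure _ _ _

theorem continuous_particlePotential (hT : 0 < T) (r : Fin n → M.Radius)
    (z : Fin n → StatePath T) : Continuous fun s : Set.Icc (0 : ℝ) T ↦
      M.particlePotential s r fun j ↦ ((z j).1 s : ℝ) := by
  have hz : Measurable z := measurable_of_finite z
  have hr : Measurable r := measurable_of_finite r
  -- The index of the particle is viewed as a uniform random variable on `Fin n`, so that the result
  -- for general laws applies.
  have h := M.continuous_potential (empiricalMeasure (id : Fin n → Fin n)) hT hz hr
  refine h.congr fun s ↦ ?_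
  have hm : Measurable fun j ↦ ((z j).1 s, r j) := ((measurable_eval_state s).comp hz).prodMk hr
  rw [map_empiricalMeasure _ hm]
  exact M.potential_empiricalMeasure _ _ _

/-- The particle system is solved exactly by the responses to the self-consistent potential of
the empirical measure of radii and noises. -/
theorem particleSystem_iff (hT : 0 < T) {r : Fin n → M.Radius} {w : Fin n → PathSpace T ℝ}
    (hw : ∀ i, initialValue (w i) = 0) {z : Fin n → StatePath T} :
    (∀ i, IsSkorokhodSolution M.a (fun s ↦ (1 / M.τ (r i)) *
      (M.particlePotential s r (fun j ↦ ((z j).1 s : ℝ)) - M.μLi ((z i).1 s)))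
      (M.σ (r i) • w i) (z i).1 (z i).2) ↔
    ∀ i, z i = M.selfResponse hT (empiricalMeasure fun j ↦ (r j, w j)) (r i, w i) := by
  constructor
  · intro h
    let Λ : PathSpace T ℝ := ⟨_, M.continuous_particlePotential hT r z⟩
    have hz : ∀ i, z i = M.response Λ (r i, w i) := fun i ↦
      (M.isSkorokhodSolution_iff (p := (r i, w i)) (Λ := Λ) (hw i) fun s ↦ rfl).1 (h i)
    -- Every particle responds to the potential of the solution, so that potential generates itself.
    have hΛ : Λ = M.selfPotential hT (empiricalMeasure fun j ↦ (r j, w j)) :=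
      M.eq_selfPotential hT fun s ↦ by
        rw [meanPotential_empiricalMeasure]
        simp_rw [← hz]
        rfl
    intro i
    rw [selfResponse, ← hΛ]
    exact hz i
  · intro h i
    refine (M.isSkorokhodSolution_iff (p := (r i, w i)) (hw i) fun s ↦ ?_).2 (h i)
    rw [← M.meanPotential_selfPotential, meanPotential_empiricalMeasure]
    simp_rw [fun j ↦ h j, selfResponse]

/-- The noises enter both directly and through the empirical measure. Uniform convergence of the
response maps allows both to vary at once. -/
theorem continuous_particle (hT : 0 < T) (r : Fin n → M.Radius) (i : Fin n) :
    Continuous fun w : Fin n → PathSpace T ℝ ↦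
      M.selfResponse hT (empiricalMeasure fun j ↦ (r j, w j)) (r i, w i) := by
  refine continuous_iff_continuousAt.2 fun w ↦ ?_
  have h1 : Continuous fun w : Fin n → PathSpace T ℝ ↦ empiricalMeasure fun j ↦ (r j, w j) :=
    continuous_empiricalMeasure.comp (by fun_prop)
  have h2 : Continuous fun w : Fin n → PathSpace T ℝ ↦ (r i, w i) := by fun_prop
  exact (M.tendsto_selfResponse hT (h1.tendsto w)).tendstoLocallyUniformly.tendsto_comp
    (M.continuous_response _).continuousAt (h2.tendsto w)

end Particles

variable {Ω : Type*} [MeasurableSpace Ω] {P : Measure Ω}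

theorem ae_eq_of_isParticleSolution (hT : 0 < T) {n : ℕ} [NeZero n] {r : Fin n → M.Radius}
    {W : Fin n → Ω → PathSpace T ℝ} (hW : ∀ i, IsBrownianPath (W i) P)
    {Z : Ω → Fin n → StatePath T} (hZ : M.IsParticleSolution P r W Z) :
    ∀ᵐ ω ∂P, Z ω =
      fun i ↦ M.selfResponse hT (empiricalMeasure fun j ↦ (r j, W j ω)) (r i, W i ω) := by
  filter_upwards [hZ.solves, ae_all_iff.2 fun i ↦ (hW i).ae_initialValue] with ω h h0
  exact funext ((M.particleSystem_iff hT h0).1 h)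

theorem exists_unique_particleSolution (hT : 0 < T) {N : ℕ} (r : Fin N → M.Radius)
    {W : Fin N → Ω → PathSpace T ℝ} (hW : ∀ i, IsBrownianPath (W i) P) :
    ∃ Z : Ω → Fin N → StatePath T, M.IsParticleSolution P r W Z ∧
      ∀ Z' : Ω → Fin N → StatePath T, M.IsParticleSolution P r W Z' → Z' =ᵐ[P] Z := by
  rcases Nat.eq_zero_or_pos N with rfl | hN
  · exact ⟨fun _ i ↦ i.elim0, ⟨measurable_const, ae_of_all _ fun _ i ↦ i.elim0⟩,
      fun Z' _ ↦ ae_of_all _ fun _ ↦ Subsingleton.elim _ _⟩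
  have : NeZero N := ⟨hN.ne'⟩
  refine ⟨fun ω i ↦ M.selfResponse hT (empiricalMeasure fun j ↦ (r j, W j ω)) (r i, W i ω),
    ⟨measurable_pi_lambda _ fun i ↦ ?_, ?_⟩, fun Z' hZ' ↦ M.ae_eq_of_isParticleSolution hT hW hZ'⟩
  · exact (M.continuous_particle hT r i).measurable.comp
      (measurable_pi_lambda _ fun j ↦ (hW j).measurable)
  · filter_upwards [ae_all_iff.2 fun i ↦ (hW i).ae_initialValue] with ω h0
    exact (M.particleSystem_iff hT h0).2 fun i ↦ rfl

/-! ### The McKean-Vlasov equation -/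

section McKeanVlasov

variable {W : Ω → PathSpace T ℝ} {R : Ω → M.Radius}
  {m : ProbabilityMeasure (M.Radius × PathSpace T ℝ)}

theorem potential_map_response (hW : Measurable W) (hR : Measurable R)
    (hm : P.map (fun ω ↦ (R ω, W ω)) = m) {Z : Ω → StatePath T} {Λ : PathSpace T ℝ}
    (hZ : ∀ᵐ ω ∂P, Z ω = M.response Λ (R ω, W ω)) (s : Set.Icc (0 : ℝ) T) :
    M.potential s (P.map fun ω ↦ ((Z ω).1 s, R ω)) = M.meanPotential m Λ s := by
  have h1 : P.map (fun ω ↦ ((Z ω).1 s, R ω)) =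
      P.map fun ω ↦ ((M.response Λ (R ω, W ω)).1 s, R ω) :=
    Measure.map_congr (hZ.mono fun ω hω ↦ by beta_reduce; rw [hω])
  rw [h1, meanPotential, ← hm, Measure.map_map _ (hR.prodMk hW)]
  · rfl
  · exact ((measurable_eval_state s).comp (M.measurable_response Λ)).prodMk measurable_fst

variable [IsProbabilityMeasure P]

/-- The law of the solution acts only through its potential, a deterministic continuous path. A
solution is therefore a response to that path, and self-consistency determines the path. -/
theorem isMcKeanVlasovSolution_iff (hT : 0 < T) (hW : Measurable W) (hR : Measurable R)
    (h0 : ∀ᵐ ω ∂P, initialValue (W ω) = 0) (hm : P.map (fun ω ↦ (R ω, W ω)) = m)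
    {Z : Ω → StatePath T} (hZ : Measurable Z) :
    M.IsMcKeanVlasovSolution P W R Z ↔ Z =ᵐ[P] fun ω ↦ M.selfResponse hT m (R ω, W ω) := by
  constructor
  · rintro ⟨-, h⟩
    let Λ : PathSpace T ℝ := ⟨_, M.continuous_potential P hT hZ hR⟩
    have hz : ∀ᵐ ω ∂P, Z ω = M.response Λ (R ω, W ω) := by
      filter_upwards [h, h0] with ω hω h0ω
      exact (M.isSkorokhodSolution_iff (p := (R ω, W ω)) (Λ := Λ) h0ω fun s ↦ rfl).1 hω
    have hΛ : Λ = M.selfPotential hT m := M.eq_selfPotential hT fun s ↦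
      (M.potential_map_response hW hR hm hz s).symm
    rw [hΛ] at hz
    exact hz
  · intro h
    refine ⟨hZ, ?_⟩
    filter_upwards [h, h0] with ω hω h0ω
    refine (M.isSkorokhodSolution_iff (p := (R ω, W ω)) h0ω fun s ↦ ?_).2 hω
    rw [drift, M.potential_map_response hW hR hm h s, M.meanPotential_selfPotential]

/-- The reflection term of a response is bounded by an affine function of the noise. -/
theorem exists_response_regulator_bound (Λ : PathSpace T ℝ) (t : Set.Icc (0 : ℝ) T) :
    ∃ C D, ∀ p, initialValue p.2 = 0 → |(M.response Λ p).2 t| ≤ C + D * |p.2 t| := by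
  obtain ⟨c, hc0, hc⟩ := M.exists_mobility_bound
  obtain ⟨B, hB⟩ := M.μLi_bounded
  obtain ⟨D, hD⟩ := M.σ_bounded
  set m := ∫ _, (1 : ℝ) ∂timeMeasure T with hm
  refine ⟨|M.a| + c * ((‖Λ‖ + B) * m) + 1, D, fun p hp ↦ ?_⟩
  have h := M.isReflected_response Λ p
  set x := (M.response Λ p).1
  have hk : (M.response Λ p).2 t = M.driver Λ p (realPath x) t - x t := by rw [h.eqn]; ring
  have hB0 : 0 ≤ B := (abs_nonneg _).trans (hB 0)
  have h1 : |primitive (Λ - M.μPath (realPath x)) t| ≤ (‖Λ‖ + B) * m := by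
    refine (abs_primitive_le _ t).trans ((primitive_mono
      (w := (‖Λ‖ + B) • (1 : PathSpace T ℝ)) fun s _ ↦ ?_).trans ?_)
    · change |Λ s - M.μLi (x s)| ≤ (‖Λ‖ + B) * 1
      rw [mul_one]
      exact (abs_sub _ _).trans (add_le_add (Λ.norm_coe_le_norm s) (hB _))
    · rw [primitive_smul]
      exact mul_le_mul_of_nonneg_left (primitive_le_integral zero_le_one t) (by positivity)
  have h2 : centered p.2 t = p.2 t := by simp [centered, hp]
  rw [hk, driver_apply, h2]
  refine (abs_sub _ _).trans ?_
  have h3 := abs_add_le (M.a + (M.τ p.1)⁻¹ * primitive (Λ - M.μPath (realPath x)) t)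
    (M.σ p.1 * p.2 t)
  have h4 := abs_add_le M.a ((M.τ p.1)⁻¹ * primitive (Λ - M.μPath (realPath x)) t)
  have h5 : |(M.τ p.1)⁻¹ * primitive (Λ - M.μPath (realPath x)) t| ≤ c * ((‖Λ‖ + B) * m) := by
    rw [abs_mul]
    exact mul_le_mul (hc _) h1 (abs_nonneg _) hc0.le
  have h6 : |M.σ p.1 * p.2 t| ≤ D * |p.2 t| := by
    rw [abs_mul]
    exact mul_le_mul_of_nonneg_right (hD _) (abs_nonneg _)
  have h7 : |(x t : ℝ)| ≤ 1 := abs_le.2 ⟨by linarith [(x t).2.1], (x t).2.2⟩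
  linarith

/-- Since `k` is the driver minus a `[0,1]`-valued path, `k t` involves the noise directly only
through `W t`, with the drift term bounded. Gaussian moments suffice. -/
theorem memLp_regulator (hT : 0 < T) (hW : IsBrownianPath W P) (hR : Measurable R)
    {p : ℝ≥0∞} (hp : p ≠ ∞) (t : Set.Icc (0 : ℝ) T) :
    MemLp (fun ω ↦ (M.selfResponse hT m (R ω, W ω)).2 t) p P := by
  obtain ⟨C, D, h⟩ := M.exists_response_regulator_bound (M.selfPotential hT m) t
  have hl := hW.hasLaw_eval t
  have hWt : MemLp (fun ω ↦ W ω t) p P := by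
    have := memLp_id_gaussianReal' (μ := 0) (v := nnTime t) p hp
    rw [← hl.map_eq] at this
    exact (memLp_map_measure_iff aestronglyMeasurable_id hl.aemeasurable).1 this
  have hg : MemLp (fun ω ↦ C + D * |W ω t|) p P := (memLp_const C).add (hWt.abs.const_mul D)
  refine hg.mono' (Measurable.aestronglyMeasurable ?_) ?_
  · exact (ContinuousEvalConst.continuous_eval_const t).measurable.comp
      (measurable_snd.comp ((M.measurable_selfResponse hT m).comp (hR.prodMk hW.measurable)))
  · filter_upwards [hW.ae_initialValue] with ω h0
    exact h (R ω, W ω) h0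

end McKeanVlasov

end Model

end Battery

end

/-! ### Assembly of the three assertions. -/

theorem proposition1p2 {T : ℝ} (hT : 0 < T) (M : Battery.Model T)
    {Ω : Type*} [MeasurableSpace Ω] (P : Measure Ω) [IsProbabilityMeasure P]
    (W : ℕ → Ω → Battery.PathSpace T ℝ) (hW : ∀ i, Battery.IsBrownianPath (W i) P)
    (hW_indep : iIndepFun W P)
    (r : ℕ → M.Radius) (lam : ProbabilityMeasure M.Radius)
    (hr : Tendsto (fun n : ℕ ↦ Battery.empiricalMeasure fun i : Fin (n + 1) ↦ r i) atTop (𝓝 lam)) :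
    -- well-posedness of the particle system, for every number of particles
    (∀ N : ℕ, ∃ Z : Ω → Fin N → Battery.StatePath T,
      M.IsParticleSolution P (fun i ↦ r i) (fun i ↦ W i) Z ∧
      ∀ Z' : Ω → Fin N → Battery.StatePath T,
        M.IsParticleSolution P (fun i ↦ r i) (fun i ↦ W i) Z' → Z' =ᵐ[P] Z) ∧
    ∃ ρ : ProbabilityMeasure (Battery.StatePath T),
      -- for all inputs with law `Wiener ⊗ λ`, the limit equation has a unique solution `(X,k)`,
      -- its marginals have all moments, and its law is `ρ`
      (∀ (Ω' : Type*) [MeasurableSpace Ω'] (P' : Measure Ω') [IsProbabilityMeasure P']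
        (W' : Ω' → Battery.PathSpace T ℝ) (R : Ω' → M.Radius),
        Battery.IsBrownianPath W' P' → Measurable R → HasLaw R (lam : Measure M.Radius) P' →
        IndepFun W' R P' →
        ∃ Z : Ω' → Battery.StatePath T,
          M.IsMcKeanVlasovSolution P' W' R Z ∧
          (∀ Z' : Ω' → Battery.StatePath T,
            M.IsMcKeanVlasovSolution P' W' R Z' → Z' =ᵐ[P'] Z) ∧
          (∀ p : ℝ≥0∞, p ≠ ∞ → ∀ t, MemLp (fun ω ↦ (Z ω).2 t) p P') ∧
          HasLaw Z (ρ : Measure (Battery.StatePath T)) P') ∧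
      -- almost surely, the empirical measures of the particle systems converge weakly to `ρ`
      (∀ Z : (N : ℕ) → Ω → Fin N → Battery.StatePath T,
        (∀ N, M.IsParticleSolution P (fun i ↦ r i) (fun i ↦ W i) (Z N)) →
        ∀ᵐ ω ∂P, Tendsto (fun n : ℕ ↦ Battery.empiricalMeasure (Z (n + 1) ω)) atTop (𝓝 ρ)) := by
  have hlaw : ∀ i, P.map (W i) = P.map (W 0) := fun i ↦ (hW i).map_eq_map (hW 0)
  let ν : ProbabilityMeasure (Battery.PathSpace T ℝ) :=
    ⟨P.map (W 0), Measure.isProbabilityMeasure_map (hW 0).measurable.aemeasurable⟩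
  -- The Wiener measure is realised as the law of `W 0`. The image of `m` under its own response map
  -- serves as `ρ`, so it does not depend on the space carrying the limit equation.
  let m : ProbabilityMeasure (M.Radius × Battery.PathSpace T ℝ) := lam.prod ν
  refine ⟨fun N ↦ M.exists_unique_particleSolution hT (fun i : Fin N ↦ r i) fun i ↦ hW i,
    m.map (f := M.selfResponse hT m) (M.measurable_selfResponse hT m).aemeasurable, ?_, ?_⟩
  · intro Ω' _ P' _ W' R hW' hR hRlaw hind
    have hm : P'.map (fun ω ↦ (R ω, W' ω)) = m := by
      rw [hind.symm.map_prod_eq_prod_map_map hR.aemeasurable hW'.measurable.aemeasurable,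
        hRlaw.map_eq, hW'.map_eq_map (hW 0)]
      rfl
    have hpair : Measurable fun ω ↦ (R ω, W' ω) := hR.prodMk hW'.measurable
    have hZ : Measurable fun ω ↦ M.selfResponse hT m (R ω, W' ω) :=
      (M.measurable_selfResponse hT m).comp hpair
    have hiff := fun {Z : Ω' → Battery.StatePath T} (hZ : Measurable Z) ↦
      M.isMcKeanVlasovSolution_iff hT hW'.measurable hR hW'.ae_initialValue hm hZ
    refine ⟨fun ω ↦ M.selfResponse hT m (R ω, W' ω), (hiff hZ).2 (ae_eq_refl _),
      fun Z' hZ' ↦ (hiff hZ'.measurable).1 hZ',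
      fun p hp t ↦ M.memLp_regulator hT hW' hR hp t, hZ.aemeasurable, ?_⟩
    change _ = (m : Measure _).map (M.selfResponse hT m)
    rw [← hm, Measure.map_map (M.measurable_selfResponse hT m) hpair]
    rfl
  · intro Z hZ
    have hconv := Battery.ae_tendsto_empiricalMeasure_prod (fun i ↦ (hW i).measurable) hW_indep
      (ν := ν) hlaw hr
    have hsol : ∀ n : ℕ, ∀ᵐ ω ∂P, Z (n + 1) ω = fun i : Fin (n + 1) ↦ M.selfResponse hT
        (Battery.empiricalMeasure fun j : Fin (n + 1) ↦ (r j, W j ω)) (r i, W i ω) := fun n ↦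
      M.ae_eq_of_isParticleSolution hT (fun i ↦ hW i) (hZ (n + 1))
    filter_upwards [hconv, ae_all_iff.2 hsol] with ω hω hZω
    -- For fixed `ω`, the empirical measure of the solutions is the image of the empirical measure
    -- of the inputs under a map depending on that same measure.
    refine Battery.tendsto_of_tendstoUniformly hω (fun n ↦ M.measurable_selfResponse hT _)
      (M.continuous_response _) (M.tendsto_selfResponse hT hω) (fun n ↦ ?_) rfl
    rw [hZω n, Battery.map_empiricalMeasure _ (M.measurable_selfResponse hT _)]
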